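/- **Setting.** A *contour* $\mathcal C$ is given by a continuous $c:[0,1]\to\mathbb C$ of finite length which has a continuous derivative except at finitely many points. Let $z_0\in\mathbb C$, let $\mathcal N$ be a neighborhood of $z_0$, and let $\mathcal C$ be a contour containing $z_0$. Let $p$ be holomorphic on a domain containing $\mathcal N\cup\mathcal C$ and not constant, so that there are an integer $\mu\ge 1$, a number $p_0\in\mathbb C\setminus\{0\}$ and a function $\phi$ holomorphic on $\mathcal N$ with $\phi(z_0)=0$ and $$p(z)=p(z_0)-p_0(z-z_0)^\mu(1-\phi(z))\qquad(z\in\mathcal N).$$ Put $\theta_\ell:=-\frac{\arg p_0}{\mu}+\frac{2\pi\ell}{\mu}$ for $\ell\in\mathbb Z$; here $\arg$ takes values in $(-\pi,\pi]$. **Corollary.** Suppose that $\mathcal C$ starts at $z_1$, passes through $z_0$ (exactly once) and ends at $z_2$, where $z_0,z_1,z_2$ are distinct. Suppose there are $k_1,k_2\in\mathbb Z$ so that, near $z_0$, $\mathcal C$ runs inwards along the ray $z_0+re^{i\theta_{k_1}}$ $(r\ge0)$ as it approaches $z_0$ and outwards along the ray $z_0+re^{i\theta_{k_2}}$ as it leaves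 $z_0$ (so that $|c(t)-z_0|$ is monotone on each side, close to $z_0$). Suppose $\operatorname{Re}p(z)<\operatorname{Re}p(z_0)$ for all $z\in\mathcal C$, $z\ne z_0$. Let $a\in\mathbb C$ with $\operatorname{Re}(a)>0$. Take $(z-z_0)^{a-1}=|z-z_0|^{a-1}e^{i\theta_{k_1}(a-1)}$ near $z_0$ on the part of $\mathcal C$ approaching $z_0$ and $(z-z_0)^{a-1}=|z-z_0|^{a-1}e^{i\theta_{k_2}(a-1)}$ near $z_0$ on the part leaving $z_0$, and extend each branch by continuity (of the argument of $z-z_0$) to the rest of the corresponding part of $\mathcal C$. Let $S\ge0$ be an integer. Then there is a constant $C$, depending on these data only, so that the following holds for every $q$ holomorphic on a domain containing $\mathcal N\cup\mathcal C$, every bound $K_q$ for $|q|$ on $\mathcal N\cup\mathcal C$ and every real $N>0$: the integral below converges absolutely, and $$\int_{\mathcal C}e^{Np(z)}(z-z_0)^{a-1}q(z)\,dz=e^{Np(z_0)}\left(\sum_{s=0}^{S-1}\Gamma\!\left(\frac{s+a}{\mu}\right)\frac{\alpha_s\left(e^{2\pi ik_2(s+a)/\mu}-e^{2\pi ik_1(s+a)/\mu}\right)}{N^{(s+a)/\mu}}+E\right),\qquad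 |E|\le C\,\frac{K_q}{N^{(S+\operatorname{Re}(a))/\mu}},$$ where, with principal powers, $$\alpha_s=\frac{1}{\mu\cdot s!}\,p_0^{-(s+a)/\mu}\,\frac{d^s}{dz^s}\Big\{q(z)\,(1-\phi(z))^{-(s+a)/\mu}\Big\}_{z=z_0}.$$ In particular the error term is $O(K_q N^{-(S+\operatorname{Re}a)/\mu})$ as $N\to\infty$, with an implied constant independent of $N$ and $q$. -/

import Mathlib

open Set Filter Topology MeasureTheory

/-- A contour: a continuous map `c : [0,1] → ℂ` with a continuous derivative except at finitely
many points, and of finite length (so that contour integrals converge absolutely).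
The contour as a set is `c '' Icc 0 1`; values of `c` outside `[0,1]` play no role. -/
structure IsContour (c : ℝ → ℂ) : Prop where
  continuousOn : ContinuousOn c (Icc 0 1)
  piecewise : ∃ E : Set ℝ, E.Finite ∧ (∀ t ∈ Ioo (0 : ℝ) 1 \ E, DifferentiableAt ℝ c t) ∧
    ContinuousOn (deriv c) (Ioo 0 1 \ E)
  finite_length : IntervalIntegrable (deriv c) volume 0 1

/-- The steepest-descent angle `θ_ℓ = -ω₀/μ + 2πℓ/μ`, where `ω₀ = arg p₀` is principal. -/
noncomputable def bisectingAngle (p₀ : ℂ) (μ : ℕ) (l : ℤ) : ℝ :=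
  -p₀.arg / μ + 2 * Real.pi * l / μ

/-- The contour `c` passes through `z₀` exactly once, at the interior parameter `t₀`. Near `z₀` it
runs inwards along the ray from `z₀` with angle `θ₁` as it approaches `z₀`, and it runs outwards
along the ray from `z₀` with angle `θ₂` as it leaves `z₀`. -/
structure PassesAlongRays (c : ℝ → ℂ) (z₀ : ℂ) (t₀ θ₁ θ₂ : ℝ) : Prop where
  mem : t₀ ∈ Ioo (0 : ℝ) 1
  eq_iff : ∀ t ∈ Icc (0 : ℝ) 1, c t = z₀ ↔ t = t₀
  approach : ∃ δ > 0, AntitoneOn (fun t => ‖c t - z₀‖) (Icc (t₀ - δ) t₀) ∧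
    ∀ t ∈ Icc (t₀ - δ) t₀, c t = z₀ + ‖c t - z₀‖ * Complex.exp (Complex.I * θ₁)
  leave : ∃ δ > 0, MonotoneOn (fun t => ‖c t - z₀‖) (Icc t₀ (t₀ + δ)) ∧
    ∀ t ∈ Icc t₀ (t₀ + δ), c t = z₀ + ‖c t - z₀‖ * Complex.exp (Complex.I * θ₂)

/-- `ϑ t` is a determination of the argument of `c t - z₀`, continuous on each of the two parts of
the contour (before and after `z₀`), equal to `θ₁` where the contour approaches `z₀` and to `θ₂`
where it leaves `z₀`. On `[0,1]` without `t₀` these conditions determine `ϑ`. -/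
structure IsArgAlong (c : ℝ → ℂ) (z₀ : ℂ) (t₀ θ₁ θ₂ : ℝ) (ϑ : ℝ → ℝ) : Prop where
  continuousOn_left : ContinuousOn ϑ (Ico 0 t₀)
  continuousOn_right : ContinuousOn ϑ (Ioc t₀ 1)
  polar : ∀ t ∈ Icc (0 : ℝ) 1, t ≠ t₀ →
    c t - z₀ = ‖c t - z₀‖ * Complex.exp (Complex.I * ϑ t)
  left_eq : ∀ᶠ t in 𝓝[<] t₀, ϑ t = θ₁
  right_eq : ∀ᶠ t in 𝓝[>] t₀, ϑ t = θ₂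

/-- The branch of `(z - z₀)^b` at `z = c t` given by the argument `ϑ t`:
`|z - z₀|^b · e^{i ϑ(t) b}`. -/
noncomputable def branchPow (c : ℝ → ℂ) (z₀ : ℂ) (ϑ : ℝ → ℝ) (b : ℂ) (t : ℝ) : ℂ :=
  (‖c t - z₀‖ : ℂ) ^ b * Complex.exp (Complex.I * ϑ t * b)

/-- The integrand `e^{N p(z)} (z - z₀)^{a-1} q(z) dz` pulled back to `[0,1]` by `c`. -/
noncomputable def perronIntegrand (c : ℝ → ℂ) (z₀ : ℂ) (ϑ : ℝ → ℝ) (a : ℂ) (p q : ℂ → ℂ)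
    (N : ℝ) (t : ℝ) : ℂ :=
  Complex.exp (N * p (c t)) * branchPow c z₀ ϑ (a - 1) t * q (c t) * deriv c t

/-- The coefficient
`α_s = 1/(μ s!) · p₀^{-(s+a)/μ} · (d/dz)^s { q(z) (1 - φ(z))^{-(s+a)/μ} }` at `z = z₀`,
with principal powers. -/
noncomputable def perronCoeff (μ : ℕ) (p₀ a : ℂ) (q φ : ℂ → ℂ) (z₀ : ℂ) (s : ℕ) : ℂ :=
  1 / ((μ : ℂ) * (s.factorial : ℂ)) * p₀ ^ (-((s : ℂ) + a) / (μ : ℂ)) *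
    iteratedDeriv s (fun z => q z * (1 - φ z) ^ (-((s : ℂ) + a) / (μ : ℂ))) z₀

/-! The contour is cut at parameters close to that of `z₀`. On the two outer pieces compactness
gives a gap `η > 0` with `Re p ≤ Re p(z₀) - η`, so relative to `e^{N p(z₀)}` they are of size
`e^{-Nη}`, which is at most a constant times any prescribed negative power of `N`, for every `N >
0`.

On the two inner pieces `z = z₀ + rω` with `p₀ ω^μ = |p₀|`. With `Λ = N|p₀|` and `u = Λ r^μ`, what
remains is the integral over `0 < r ≤ R` of `r^{a-1} e^{-u} · e^{uφ(z)} q(z)`. No inverse function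
is needed: with `u` frozen, `e^{uφ} q` is expanded in a Taylor series at `z₀`. On a disc where `|φ|
≤ 1/2` it is at most `K e^{u/2}`, so Cauchy's estimates bound the remainder by a multiple of `K
e^{u/2} r^S`. The factor `e^{-u}` leaves `e^{-u/2}`, and integration over `r` gives `Λ^{-(S + Re
a)/μ}`, uniformly in `q` and `Λ` (`exists_bound_integral_rayIntegrand`).

The Taylor terms are integrated over the whole half-line. Cauchy's formula and Fubini move the
`r`-integral inside the derivative, where it is an Euler integral with complex scale `Λ(1 - φ)`;
this turns `e^{uφ} q` into `q (1 - φ)^{-(s+a)/μ}` (`integral_iteratedDeriv_exp_mul`). -/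

/-! ### Taylor remainders and Euler integrals -/

/-- Taylor remainder of a holomorphic function on the half-size disc, from a bound on the circle. -/
lemma norm_sub_taylorSum_le {f : ℂ → ℂ} {z₀ : ℂ} {ρ M : ℝ} (hρ : 0 < ρ)
    (hf : DiffContOnCl ℂ f (Metric.ball z₀ ρ)) (hM : ∀ z ∈ Metric.sphere z₀ ρ, ‖f z‖ ≤ M)
    (S : ℕ) {z : ℂ} (hz : ‖z - z₀‖ ≤ ρ / 2) :
    ‖f z - ∑ s ∈ Finset.range S, (s.factorial : ℂ)⁻¹ * iteratedDeriv s f z₀ * (z - z₀) ^ s‖ ≤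
      2 * M * (‖z - z₀‖ / ρ) ^ S := by
  have hzb : z ∈ Metric.ball z₀ ρ := by
    rw [mem_ball_iff_norm]; linarith
  have hsum := Complex.hasSum_taylorSeries_on_ball hf.differentiableOn hzb
  have hsum' : HasSum (fun s : ℕ => (s.factorial : ℂ)⁻¹ * iteratedDeriv s f z₀ * (z - z₀) ^ s)
      (f z) := by
    refine hsum.congr_fun (fun s => ?_) |> fun h => h
    simp only [smul_eq_mul]; ring
  have htail := (hasSum_nat_add_iff' S).2 hsum'
  set x := ‖z - z₀‖ / ρ with hx
  have hx0 : 0 ≤ x := by positivity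
  have hx1 : x ≤ 1 / 2 := by rw [hx, div_le_iff₀ hρ]; linarith
  have hM0 : 0 ≤ M := by
    obtain ⟨w, hw⟩ := (NormedSpace.sphere_nonempty (x := z₀) (r := ρ)).2 hρ.le
    exact (norm_nonneg _).trans (hM w hw)
  have hbound : ∀ n : ℕ, ‖((n + S).factorial : ℂ)⁻¹ * iteratedDeriv (n + S) f z₀ *
      (z - z₀) ^ (n + S)‖ ≤ M * x ^ S * (1 / 2) ^ n := by
    intro n
    have h := Complex.norm_iteratedDeriv_le_of_forall_mem_sphere_norm_le (n + S) hρ hf hM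
    have hfac : (0 : ℝ) < (n + S).factorial := by exact_mod_cast Nat.factorial_pos _
    rw [norm_mul, norm_mul, norm_inv, Complex.norm_natCast, norm_pow]
    calc _ ≤ ((n + S).factorial : ℝ)⁻¹ * ((n + S).factorial * M / ρ ^ (n + S)) *
          ‖z - z₀‖ ^ (n + S) := by gcongr
      _ = M * x ^ S * x ^ n := by rw [hx, div_pow, div_pow]; field_simp; ring
      _ ≤ _ := by gcongr
  -- On the half-size disc the ratio is at most 1/2, so the tail is at most twice the bound for its
  -- first term.
  have hg : HasSum (fun n : ℕ => M * x ^ S * (1 / 2 : ℝ) ^ n) (M * x ^ S * 2) :=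
    hasSum_geometric_two.mul_left _
  have := htail.norm_le_of_bounded hg hbound
  linarith

lemma integrableOn_cpow_mul_exp_neg_mul {a w : ℂ} (ha : 0 < a.re) (hw : 0 < w.re) :
    IntegrableOn (fun x : ℝ => (x : ℂ) ^ (a - 1) * Complex.exp (-(w * x))) (Ioi 0) := by
  have hint := integrableOn_rpow_mul_exp_neg_mul_rpow (p := 1) (s := a.re - 1) (b := w.re)
    (by linarith) one_pos hw
  refine hint.mono' ?_ ?_
  · refine ContinuousOn.aestronglyMeasurable (fun x hx => ?_) measurableSet_Ioi
    have : ContinuousAt (fun x : ℝ => (x : ℂ) ^ (a - 1)) x :=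
      Complex.continuousAt_ofReal_cpow_const _ _ (Or.inr (ne_of_gt hx))
    exact (this.mul (by fun_prop)).continuousWithinAt
  · refine (ae_restrict_iff' measurableSet_Ioi).2 (ae_of_all _ fun x hx => ?_)
    rw [norm_mul, Complex.norm_cpow_eq_rpow_re_of_pos hx, Complex.norm_exp]
    simp

/-- The Euler integral with a complex scale parameter in the right half-plane. -/
lemma integral_cpow_mul_exp_neg_mul_complex {a w : ℂ} (ha : 0 < a.re) (hw : 0 < w.re) :
    ∫ x : ℝ in Ioi 0, (x : ℂ) ^ (a - 1) * Complex.exp (-(w * x)) =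
      w ^ (-a) * Complex.Gamma a := by
  -- Both sides are holomorphic in `w` on the right half-plane and agree for real `w`; the identity
  -- theorem does the rest.
  set U : Set ℂ := {w | 0 < w.re} with hU
  have hUo : IsOpen U := isOpen_lt continuous_const Complex.continuous_re
  have hUc : IsPreconnected U := (convex_halfSpace_re_gt 0).isPreconnected
  set F : ℂ → ℂ := fun w => ∫ x : ℝ in Ioi 0, (x : ℂ) ^ (a - 1) * Complex.exp (-(w * x))
  have hF : DifferentiableOn ℂ F U := by
    intro v hv
    have hv : 0 < v.re := hv
    -- The radius `v.re / 2` keeps `Re u ≥ v.re / 2`, which gives one integrable majorant for all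
    -- derivatives near `v`.
    have hball : ∀ u ∈ Metric.ball v (v.re / 2), v.re / 2 ≤ u.re := by
      intro u hu
      have h1 := Complex.abs_re_le_norm (u - v)
      rw [mem_ball_iff_norm] at hu
      have h2 := (abs_lt.1 (h1.trans_lt hu)).1
      simp only [Complex.sub_re] at h2
      linarith
    have h := hasDerivAt_integral_of_dominated_loc_of_deriv_le
      (μ := volume.restrict (Ioi (0 : ℝ)))
      (F := fun (w : ℂ) (x : ℝ) => (x : ℂ) ^ (a - 1) * Complex.exp (-(w * x)))
      (F' := fun (w : ℂ) (x : ℝ) => (x : ℂ) ^ (a - 1) * (Complex.exp (-(w * x)) * (-x)))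
      (bound := fun x : ℝ => x ^ (a.re) * Real.exp (-(v.re / 2) * x ^ (1 : ℝ)))
      (x₀ := v) (Metric.ball_mem_nhds v (half_pos hv)) ?_ ?_ ?_ ?_ ?_ ?_
    · exact h.2.differentiableAt.differentiableWithinAt
    · filter_upwards [hUo.mem_nhds hv] with u hu
      exact (integrableOn_cpow_mul_exp_neg_mul ha hu).aestronglyMeasurable
    · exact integrableOn_cpow_mul_exp_neg_mul ha hv
    · have := (integrableOn_cpow_mul_exp_neg_mul ha hv).aestronglyMeasurable.mul
        (Continuous.aestronglyMeasurable (f := fun x : ℝ => (-x : ℂ)) (by fun_prop))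
      refine this.congr (ae_of_all _ fun x => ?_)
      simp only [Pi.mul_apply]; ring
    · refine (ae_restrict_iff' measurableSet_Ioi).2 (ae_of_all _ fun x hx u hu => ?_)
      have hx : 0 < x := hx
      rw [norm_mul, norm_mul, Complex.norm_cpow_eq_rpow_re_of_pos hx, Complex.norm_exp, norm_neg,
        Complex.norm_real, Real.norm_of_nonneg hx.le]
      have e1 : x ^ a.re = x ^ (a - 1).re * x := by
        rw [Complex.sub_re, Complex.one_re, ← Real.rpow_add_one hx.ne']; congr 1; ring
      have e2 : (-(u * x)).re = -(u.re * x) := by simp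
      rw [e1, e2, Real.rpow_one, mul_assoc, mul_comm (Real.exp _)]
      have := hball u hu
      gcongr
      nlinarith
    · exact integrableOn_rpow_mul_exp_neg_mul_rpow (by linarith) one_pos (half_pos hv)
    · refine ae_of_all _ fun x u hu => ?_
      have : HasDerivAt (fun w : ℂ => -(w * x)) (-x : ℂ) u := by
        simpa using! ((hasDerivAt_id u).mul_const (x : ℂ)).neg
      exact (this.cexp).const_mul _
  have hG : DifferentiableOn ℂ (fun w : ℂ => w ^ (-a) * Complex.Gamma a) U := by
    intro v hv
    have : DifferentiableAt ℂ (fun w : ℂ => w ^ (-a)) v :=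
      differentiableAt_id.cpow_const (Or.inl hv)
    exact (this.mul_const _).differentiableWithinAt
  have hreal : ∀ r : ℝ, 0 < r → F r = (r : ℂ) ^ (-a) * Complex.Gamma a := by
    intro r hr
    have := Complex.integral_cpow_mul_exp_neg_mul_Ioi ha hr
    simp only [F]
    rw [this, one_div, Complex.inv_cpow_ofReal_nonneg hr.le, Complex.cpow_neg]
  have hfreq : ∃ᶠ z in 𝓝[≠] (1 : ℂ), F z = z ^ (-a) * Complex.Gamma a := by
    have ht : Tendsto (fun n : ℕ => ((1 + 1 / ((n : ℝ) + 1) : ℝ) : ℂ)) atTop (𝓝[≠] (1 : ℂ)) := by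
      refine tendsto_nhdsWithin_iff.2 ⟨?_, Eventually.of_forall fun n => ?_⟩
      · have := (tendsto_one_div_add_atTop_nhds_zero_nat (𝕜 := ℝ)).const_add 1
        have := (Complex.continuous_ofReal.tendsto _).comp this
        simpa [Function.comp_def] using this
      · have : (0 : ℝ) < 1 / ((n : ℝ) + 1) := by positivity
        intro h
        have h : ((1 + 1 / ((n : ℝ) + 1) : ℝ) : ℂ) = ((1 : ℝ) : ℂ) := by simpa using h
        have := Complex.ofReal_injective h
        linarith
    refine ht.frequently (Frequently.of_forall fun n => hreal _ (by positivity))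
  have := (hF.analyticOnNhd hUo).eqOn_of_preconnected_of_frequently_eq (hG.analyticOnNhd hUo) hUc
    (show (1 : ℂ) ∈ U by simp [hU]) hfreq
  exact this hw

lemma integrableOn_rpow_mul_exp_neg_mul_pow {μ : ℕ} (hμ : 1 ≤ μ) {b v : ℝ} (hb : 0 < b)
    (hv : 0 < v) :
    IntegrableOn (fun r : ℝ => r ^ (b - 1) * Real.exp (-(v * r ^ μ))) (Ioi 0) := by
  have := integrableOn_rpow_mul_exp_neg_mul_rpow (p := μ) (s := b - 1) (b := v)
    (by linarith) (by exact_mod_cast hμ) hv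
  simpa using this

lemma integral_rpow_mul_exp_neg_mul_pow {μ : ℕ} (hμ : 1 ≤ μ) {b v : ℝ} (hb : 0 < b)
    (hv : 0 < v) :
    ∫ r : ℝ in Ioi 0, r ^ (b - 1) * Real.exp (-(v * r ^ μ)) =
      v ^ (-(b / μ)) * (1 / μ) * Real.Gamma (b / μ) := by
  have := integral_rpow_mul_exp_neg_mul_rpow (p := μ) (q := b - 1) (b := v)
    (by exact_mod_cast hμ) (by linarith) hv
  simpa [neg_div] using this

/-- Substitute `x = r^μ` in the Euler integral with exponent `b/μ`. The scale `w` has to be complex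
because it becomes `Λ(1 - φ(z))` with `z` on a circle. -/
lemma integral_cpow_mul_exp_neg_mul_pow {μ : ℕ} (hμ : 1 ≤ μ) {b w : ℂ} (hb : 0 < b.re)
    (hw : 0 < w.re) :
    ∫ r : ℝ in Ioi 0, (r : ℂ) ^ (b - 1) * Complex.exp (-(w * (r : ℂ) ^ μ)) =
      1 / μ * Complex.Gamma (b / μ) * w ^ (-(b / μ)) := by
  have hμ0 : (0 : ℝ) < μ := by exact_mod_cast hμ
  have hμc : (μ : ℂ) ≠ 0 := by exact_mod_cast hμ0.ne'
  have hre : 0 < (b / μ).re := by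
    have : (b / μ).re = b.re / μ := by simp
    rw [this]; positivity
  have h1 := integral_cpow_mul_exp_neg_mul_complex hre hw
  rw [← integral_comp_rpow_Ioi_of_pos hμ0] at h1
  have h2 : ∫ r : ℝ in Ioi 0, (r : ℂ) ^ (b - 1) * Complex.exp (-(w * (r : ℂ) ^ μ)) =
      ∫ r : ℝ in Ioi 0, (1 / μ : ℂ) * ((μ * r ^ ((μ : ℝ) - 1)) •
        (((r ^ (μ : ℝ) : ℝ) : ℂ) ^ (b / μ - 1) * Complex.exp (-(w * (r ^ (μ : ℝ) : ℝ))))) := by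
    refine setIntegral_congr_fun measurableSet_Ioi fun r hr => ?_
    have hr : 0 < r := hr
    have hrc : (r : ℂ) ≠ 0 := by exact_mod_cast hr.ne'
    have e1 : ((r ^ (μ : ℝ) : ℝ) : ℂ) ^ (b / μ - 1) = (r : ℂ) ^ (b - μ) := by
      have hne : ((r ^ (μ : ℝ) : ℝ) : ℂ) ≠ 0 :=
        Complex.ofReal_ne_zero.2 (Real.rpow_pos_of_pos hr _).ne'
      rw [Complex.cpow_def_of_ne_zero hne,
        Complex.cpow_def_of_ne_zero hrc, ← Complex.ofReal_log (by positivity), Real.log_rpow hr,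
        ← Complex.ofReal_log hr.le]
      congr 1
      push_cast
      field_simp
    have e2 : (r : ℂ) ^ (b - 1) = (r : ℂ) ^ ((μ : ℂ) - 1) * (r : ℂ) ^ (b - μ) := by
      rw [← Complex.cpow_add _ _ hrc]; congr 1; ring
    have e3 : ((r ^ ((μ : ℝ) - 1) : ℝ) : ℂ) = (r : ℂ) ^ ((μ : ℂ) - 1) := by
      rw [Complex.ofReal_cpow hr.le]; push_cast; rfl
    have e4 : ((r ^ (μ : ℝ) : ℝ) : ℂ) = (r : ℂ) ^ μ := by
      rw [Real.rpow_natCast]; push_cast; rfl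
    rw [e1, e2, Complex.real_smul, Complex.ofReal_mul, e3, e4]
    push_cast
    field_simp
  rw [h2, integral_const_mul, h1]
  ring

/-! ### Expansion of the integral along a ray -/

/-- Cauchy's formula for the Taylor coefficients, as integration against a continuous kernel. -/
lemma exists_kernel_iteratedDeriv (z₀ : ℂ) {ρ : ℝ} (hρ : 0 < ρ) (m : ℕ) :
    ∃ k : ℝ → ℂ, Continuous k ∧ ∀ f : ℂ → ℂ, DiffContOnCl ℂ f (Metric.ball z₀ ρ) →
      iteratedDeriv m f z₀ = ∫ θ in (0 : ℝ)..2 * Real.pi, k θ * f (circleMap z₀ ρ θ) := by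
  -- The kernel does not depend on `f`, so one `k` serves the whole family `e^{uφ} q` as well as the
  -- integrated function, as Fubini requires.
  refine ⟨fun θ => (2 * Real.pi * Complex.I / m.factorial)⁻¹ *
    (circleMap 0 ρ θ * Complex.I * (1 / (circleMap z₀ ρ θ - z₀) ^ (m + 1))), ?_, ?_⟩
  · refine continuous_const.mul (((continuous_circleMap 0 ρ).mul continuous_const).mul ?_)
    refine continuous_const.div (((continuous_circleMap z₀ ρ).sub continuous_const).pow _) ?_
    intro θ
    refine pow_ne_zero _ (sub_ne_zero.2 (circleMap_ne_center hρ.ne'))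
  · intro f hf
    have h := hf.circleIntegral_one_div_sub_center_pow_smul hρ m
    have hne : (2 * Real.pi * Complex.I / m.factorial : ℂ) ≠ 0 := by
      simp [Nat.factorial_ne_zero]
    rw [circleIntegral] at h
    simp only [smul_eq_mul, deriv_circleMap] at h
    rw [← mul_right_inj' hne, ← h, ← intervalIntegral.integral_const_mul]
    refine intervalIntegral.integral_congr fun θ _ => ?_
    simp only
    rw [mul_assoc (_ : ℂ)⁻¹, mul_inv_cancel_left₀ hne]
    ring

section LocalExpansion

variable {z₀ : ℂ} {ρ : ℝ} {μ : ℕ} {φ q : ℂ → ℂ} {K : ℝ}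

lemma diffContOnCl_ball_of_closedBall {f : ℂ → ℂ} (hf : DifferentiableOn ℂ f (Metric.closedBall z₀ ρ)) :
    DiffContOnCl ℂ f (Metric.ball z₀ ρ) :=
  (hf.mono Metric.closure_ball_subset_closedBall).diffContOnCl

lemma continuous_comp_circleMap {f : ℂ → ℂ} (hρ : 0 < ρ)
    (hf : DifferentiableOn ℂ f (Metric.closedBall z₀ ρ)) :
    Continuous fun θ => f (circleMap z₀ ρ θ) :=
  hf.continuousOn.comp_continuous (continuous_circleMap z₀ ρ)
    fun θ => circleMap_mem_closedBall z₀ hρ.le θ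

/-- Keeps `1 - φ` in the right half-plane, where principal powers are holomorphic and the Euler
integrals converge. -/
lemma one_sub_re_ge {w : ℂ} (hw : ‖w‖ ≤ 1 / 2) : 1 / 2 ≤ (1 - w).re := by
  have := (Complex.re_le_norm w).trans hw
  simp only [Complex.sub_re, Complex.one_re]; linarith

lemma norm_exp_ofReal_mul_le {w : ℂ} (hw : ‖w‖ ≤ 1 / 2) {u : ℝ} (hu : 0 ≤ u) :
    ‖Complex.exp (u * w)‖ ≤ Real.exp (u / 2) := by
  rw [Complex.norm_exp]
  have := (Complex.re_le_norm w).trans hw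
  simp only [Complex.mul_re, Complex.ofReal_re, Complex.ofReal_im, zero_mul, sub_zero]
  gcongr
  nlinarith

lemma differentiableOn_mul_one_sub_cpow (hφ : DifferentiableOn ℂ φ (Metric.closedBall z₀ ρ))
    (hφ2 : ∀ z ∈ Metric.closedBall z₀ ρ, ‖φ z‖ ≤ 1 / 2)
    (hq : DifferentiableOn ℂ q (Metric.closedBall z₀ ρ)) (x : ℂ) :
    DifferentiableOn ℂ (fun z => q z * (1 - φ z) ^ x) (Metric.closedBall z₀ ρ) := by
  refine hq.mul (DifferentiableOn.cpow_const ((differentiableOn_const 1).sub hφ) fun z hz => Or.inl ?_)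
  have := one_sub_re_ge (hφ2 z hz)
  linarith

lemma ofReal_mul_cpow_of_re_pos {Λ : ℝ} (hΛ : 0 < Λ) {w : ℂ} (hw : 0 < w.re) (x : ℂ) :
    ((Λ : ℂ) * w) ^ x = (Λ : ℂ) ^ x * w ^ x := by
  have hΛc : (Λ : ℂ) ≠ 0 := by exact_mod_cast hΛ.ne'
  have hw0 : w ≠ 0 := by rintro rfl; simp at hw
  rw [Complex.cpow_def_of_ne_zero (mul_ne_zero hΛc hw0), Complex.cpow_def_of_ne_zero hΛc,
    Complex.cpow_def_of_ne_zero hw0, ← Complex.exp_add, Complex.log_ofReal_mul hΛ hw0,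
    Complex.ofReal_log hΛ.le]
  ring_nf

/-- Integrating the Taylor coefficients of `e^{u φ} q` against the Laplace weight, `u = Λ r^μ`,
gives the Taylor coefficients of `q (1 - φ)^{-b/μ}`. -/
lemma integral_iteratedDeriv_exp_mul (hρ : 0 < ρ) (hμ : 1 ≤ μ)
    (hφ : DifferentiableOn ℂ φ (Metric.closedBall z₀ ρ))
    (hφ2 : ∀ z ∈ Metric.closedBall z₀ ρ, ‖φ z‖ ≤ 1 / 2)
    (hq : DifferentiableOn ℂ q (Metric.closedBall z₀ ρ))
    {b : ℂ} (hb : 0 < b.re) (m : ℕ) {Λ : ℝ} (hΛ : 0 < Λ) :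
    IntegrableOn (fun r : ℝ => Complex.exp (-((Λ * r ^ μ : ℝ) : ℂ)) * (r : ℂ) ^ (b - 1) *
      iteratedDeriv m (fun z => Complex.exp ((Λ * r ^ μ : ℝ) * φ z) * q z) z₀) (Ioi 0) ∧
    ∫ r : ℝ in Ioi 0, Complex.exp (-((Λ * r ^ μ : ℝ) : ℂ)) * (r : ℂ) ^ (b - 1) *
      iteratedDeriv m (fun z => Complex.exp ((Λ * r ^ μ : ℝ) * φ z) * q z) z₀ =
    1 / μ * Complex.Gamma (b / μ) * (Λ : ℂ) ^ (-(b / μ)) *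
      iteratedDeriv m (fun z => q z * (1 - φ z) ^ (-(b / μ))) z₀ := by
  obtain ⟨k, hk, hkf⟩ := exists_kernel_iteratedDeriv z₀ hρ m
  have hφc := continuous_comp_circleMap hρ hφ
  have hqc := continuous_comp_circleMap hρ hq
  have hmem : ∀ θ, circleMap z₀ ρ θ ∈ Metric.closedBall z₀ ρ :=
    fun θ => circleMap_mem_closedBall z₀ hρ.le θ
  have hdiff : ∀ u : ℂ, DiffContOnCl ℂ (fun z => Complex.exp (u * φ z) * q z)
      (Metric.ball z₀ ρ) := fun u =>
    diffContOnCl_ball_of_closedBall (((hφ.const_mul u).cexp).mul hq)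
  set F : ℝ → ℝ → ℂ := fun θ r => k θ * q (circleMap z₀ ρ θ) * ((r : ℂ) ^ (b - 1) *
    Complex.exp (-((Λ * (1 - φ (circleMap z₀ ρ θ))) * (r : ℂ) ^ μ))) with hF
  have hkq : Continuous fun θ => k θ * q (circleMap z₀ ρ θ) := hk.mul hqc
  obtain ⟨B, hB⟩ := (isCompact_uIcc (a := (0 : ℝ)) (b := 2 * Real.pi)).exists_bound_of_continuousOn
    hkq.continuousOn
  -- Since `Re (1 - φ) ≥ 1/2` on the circle, `B r^{Re b - 1} e^{-Λ r^μ / 2}` dominates uniformly in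
  -- the angle.
  have hint : Integrable (Function.uncurry F)
      ((volume.restrict (uIoc 0 (2 * Real.pi))).prod (volume.restrict (Ioi 0))) := by
    have hg := (integrableOn_rpow_mul_exp_neg_mul_pow hμ hb (half_pos hΛ)).const_mul B
    have : IsFiniteMeasure (volume.restrict (uIoc (0 : ℝ) (2 * Real.pi))) := by
      rw [uIoc_of_le Real.two_pi_pos.le]; infer_instance
    have hg2 := hg.comp_snd (volume.restrict (uIoc (0 : ℝ) (2 * Real.pi)))
    refine hg2.mono' ?_ ?_
    · rw [Measure.prod_restrict]
      refine ContinuousOn.aestronglyMeasurable ?_ (measurableSet_uIoc.prod measurableSet_Ioi)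
      rintro ⟨θ, r⟩ ⟨-, hr⟩
      have hr : 0 < r := hr
      have h1 : ContinuousAt (fun x : ℝ × ℝ => (x.2 : ℂ) ^ (b - 1)) (θ, r) :=
        ContinuousAt.comp (f := Prod.snd) (x := (θ, r))
          (Complex.continuousAt_ofReal_cpow_const r (b - 1) (Or.inr hr.ne')) continuousAt_snd
      refine ContinuousAt.continuousWithinAt ?_
      refine (hkq.comp continuous_fst).continuousAt.mul (h1.mul (Continuous.continuousAt ?_))
      have := hφc.comp (continuous_fst (X := ℝ) (Y := ℝ))
      exact ((continuous_const.mul (continuous_const.sub this)).mul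
        ((Complex.continuous_ofReal.comp continuous_snd).pow μ)).neg.cexp
    · rw [Measure.prod_restrict]
      refine (ae_restrict_iff' (measurableSet_uIoc.prod measurableSet_Ioi)).2
        (ae_of_all _ ?_)
      rintro ⟨θ, r⟩ ⟨hθ, hr⟩
      have hr : 0 < r := hr
      simp only [Function.uncurry, hF]
      rw [norm_mul, norm_mul (_ ^ _), Complex.norm_cpow_eq_rpow_re_of_pos hr, Complex.norm_exp]
      have h1 := hB θ (uIoc_subset_uIcc hθ)
      have h2 := one_sub_re_ge (hφ2 _ (hmem θ))
      have hre : (-((Λ * (1 - φ (circleMap z₀ ρ θ))) * (r : ℂ) ^ μ)).re =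
          -(Λ * (1 - φ (circleMap z₀ ρ θ)).re * r ^ μ) := by
        rw [← Complex.ofReal_pow, Complex.neg_re, Complex.re_mul_ofReal, Complex.re_ofReal_mul]
      rw [hre]
      have hB0 : 0 ≤ B := (norm_nonneg _).trans h1
      have hb1 : (b - 1).re = b.re - 1 := by simp
      rw [hb1]
      gcongr
      rw [div_eq_mul_one_div]
      gcongr
  have hinner : ∀ r ∈ Ioi (0 : ℝ), ∫ θ in (0 : ℝ)..2 * Real.pi, F θ r =
      Complex.exp (-((Λ * r ^ μ : ℝ) : ℂ)) * (r : ℂ) ^ (b - 1) *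
      iteratedDeriv m (fun z => Complex.exp ((Λ * r ^ μ : ℝ) * φ z) * q z) z₀ := by
    intro r _
    rw [hkf _ (hdiff _), ← intervalIntegral.integral_const_mul]
    refine intervalIntegral.integral_congr fun θ _ => ?_
    have : Complex.exp (-((Λ * (1 - φ (circleMap z₀ ρ θ))) * (r : ℂ) ^ μ)) =
        Complex.exp (-((Λ * r ^ μ : ℝ) : ℂ)) *
          Complex.exp ((Λ * r ^ μ : ℝ) * φ (circleMap z₀ ρ θ)) := by
      rw [← Complex.exp_add]; congr 1; push_cast; ring
    simp only [hF]
    rw [this]; ring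
  refine ⟨?_, ?_⟩
  · have h := hint.integral_prod_right
    refine IntegrableOn.congr_fun (f := fun r => ∫ θ in (0 : ℝ)..2 * Real.pi, F θ r) ?_ hinner
      measurableSet_Ioi
    simp only [intervalIntegral.integral_of_le Real.two_pi_pos.le]
    rw [uIoc_of_le Real.two_pi_pos.le] at h
    exact h
  · rw [← setIntegral_congr_fun measurableSet_Ioi hinner, ← intervalIntegral_integral_swap hint,
      hkf _ (diffContOnCl_ball_of_closedBall (differentiableOn_mul_one_sub_cpow hφ hφ2 hq _)),
      ← intervalIntegral.integral_const_mul]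
    refine intervalIntegral.integral_congr fun θ _ => ?_
    have h2 := one_sub_re_ge (hφ2 _ (hmem θ))
    have hw : 0 < (Λ * (1 - φ (circleMap z₀ ρ θ))).re := by
      rw [Complex.re_ofReal_mul]; nlinarith
    simp only [hF]
    rw [integral_const_mul, integral_cpow_mul_exp_neg_mul_pow hμ hb hw,
      ofReal_mul_cpow_of_re_pos hΛ (by linarith)]
    ring

/-- The integrand along a ray, `u = Λ r^μ`. -/
noncomputable def rayIntegrand (z₀ : ℂ) (μ : ℕ) (φ q : ℂ → ℂ) (a ω : ℂ) (Λ r : ℝ) : ℂ :=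
  Complex.exp (-(Λ * (r : ℂ) ^ μ * (1 - φ (z₀ + r * ω)))) * (r : ℂ) ^ (a - 1) * q (z₀ + r * ω)

/-- Separates the weight `e^{-u}` from `e^{uφ} q`, the function that is Taylor expanded with `u`
held fixed. -/
lemma rayIntegrand_eq (a ω : ℂ) (Λ r : ℝ) :
    rayIntegrand z₀ μ φ q a ω Λ r = Complex.exp (-((Λ * r ^ μ : ℝ) : ℂ)) * (r : ℂ) ^ (a - 1) *
      (Complex.exp ((Λ * r ^ μ : ℝ) * φ (z₀ + r * ω)) * q (z₀ + r * ω)) := by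
  have : Complex.exp (-(Λ * (r : ℂ) ^ μ * (1 - φ (z₀ + r * ω)))) =
      Complex.exp (-((Λ * r ^ μ : ℝ) : ℂ)) * Complex.exp ((Λ * r ^ μ : ℝ) * φ (z₀ + r * ω)) := by
    rw [← Complex.exp_add]; congr 1; push_cast; ring
  rw [rayIntegrand, this]; ring

lemma add_ofReal_mul_mem_closedBall {ω : ℂ} (hω : ‖ω‖ = 1) {r : ℝ} (hr : 0 ≤ r) (hrρ : r ≤ ρ) :
    z₀ + r * ω ∈ Metric.closedBall z₀ ρ := by
  simp [hω, abs_of_nonneg hr, hrρ]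

lemma continuousOn_rayIntegrand (hφ : DifferentiableOn ℂ φ (Metric.closedBall z₀ ρ))
    (hq : DifferentiableOn ℂ q (Metric.closedBall z₀ ρ)) {ω : ℂ} (hω : ‖ω‖ = 1) (a : ℂ) (Λ : ℝ) :
    ContinuousOn (rayIntegrand z₀ μ φ q a ω Λ) (Ioc 0 ρ) := by
  have hm : MapsTo (fun r : ℝ => z₀ + r * ω) (Ioc 0 ρ) (Metric.closedBall z₀ ρ) :=
    fun r hr => add_ofReal_mul_mem_closedBall hω hr.1.le hr.2
  have hl : ContinuousOn (fun r : ℝ => z₀ + r * ω) (Ioc 0 ρ) := by fun_prop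
  have h1 := hφ.continuousOn.comp hl hm
  have h2 := hq.continuousOn.comp hl hm
  have h3 : ContinuousOn (fun r : ℝ => (r : ℂ) ^ (a - 1)) (Ioc 0 ρ) := fun r hr =>
    (Complex.continuousAt_ofReal_cpow_const r _ (Or.inr hr.1.ne')).continuousWithinAt
  simp only [Function.comp_def] at h1 h2
  have h4 : ContinuousOn (fun r : ℝ => (Λ : ℂ) * (r : ℂ) ^ μ) (Ioc 0 ρ) :=
    (continuous_const.mul (Complex.continuous_ofReal.pow μ)).continuousOn
  exact (((h4.mul (continuousOn_const.sub h1)).neg.cexp).mul h3).mul h2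

lemma norm_rayIntegrand_le (hφ2 : ∀ z ∈ Metric.closedBall z₀ ρ, ‖φ z‖ ≤ 1 / 2)
    (hK : ∀ z ∈ Metric.closedBall z₀ ρ, ‖q z‖ ≤ K) {ω : ℂ} (hω : ‖ω‖ = 1) (a : ℂ) {Λ : ℝ}
    (hΛ : 0 ≤ Λ) {r : ℝ} (hr : r ∈ Ioc 0 ρ) :
    ‖rayIntegrand z₀ μ φ q a ω Λ r‖ ≤ K * r ^ (a.re - 1) := by
  have hm := add_ofReal_mul_mem_closedBall (z₀ := z₀) hω hr.1.le hr.2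
  rw [rayIntegrand, norm_mul, norm_mul, Complex.norm_cpow_eq_rpow_re_of_pos hr.1,
    Complex.sub_re, Complex.one_re, mul_comm, Complex.norm_exp]
  have h1 := hK _ hm
  have h2 := one_sub_re_ge (hφ2 _ hm)
  have hK0 := (norm_nonneg _).trans h1
  have hr0 := hr.1
  have h3 : Real.exp (-(Λ * (r : ℂ) ^ μ * (1 - φ (z₀ + r * ω)))).re ≤ 1 := by
    rw [Real.exp_le_one_iff, ← Complex.ofReal_pow, ← Complex.ofReal_mul, Complex.neg_re,
      Complex.re_ofReal_mul]
    have : 0 ≤ Λ * r ^ μ := by positivity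
    nlinarith
  have h4 : 0 ≤ r ^ (a.re - 1) := by positivity
  calc _ ≤ K * (1 * r ^ (a.re - 1)) := by gcongr
    _ = _ := by ring

lemma integrableOn_rayIntegrand (hφ : DifferentiableOn ℂ φ (Metric.closedBall z₀ ρ))
    (hφ2 : ∀ z ∈ Metric.closedBall z₀ ρ, ‖φ z‖ ≤ 1 / 2)
    (hq : DifferentiableOn ℂ q (Metric.closedBall z₀ ρ))
    (hK : ∀ z ∈ Metric.closedBall z₀ ρ, ‖q z‖ ≤ K) {ω : ℂ} (hω : ‖ω‖ = 1) {a : ℂ} (ha : 0 < a.re)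
    {Λ : ℝ} (hΛ : 0 ≤ Λ) {R : ℝ} (hRρ : R ≤ ρ) :
    IntegrableOn (rayIntegrand z₀ μ φ q a ω Λ) (Ioc 0 R) := by
  rcases le_or_gt R 0 with hR | hR
  · simp [Ioc_eq_empty hR.not_gt]
  have hg : IntegrableOn (fun r : ℝ => K * r ^ (a.re - 1)) (Ioc 0 R) := by
    have := (intervalIntegral.intervalIntegrable_rpow' (a := 0) (b := R)
      (by linarith : -1 < a.re - 1)).const_mul K
    rwa [intervalIntegrable_iff_integrableOn_Ioc_of_le hR.le] at this
  have hsub : Ioc 0 R ⊆ Ioc 0 ρ := Ioc_subset_Ioc_right hRρ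
  refine hg.mono' (((continuousOn_rayIntegrand hφ hq hω a Λ).mono hsub).aestronglyMeasurable
    measurableSet_Ioc) ?_
  exact (ae_restrict_iff' measurableSet_Ioc).2
    (ae_of_all _ fun r hr => norm_rayIntegrand_le hφ2 hK hω a hΛ (hsub hr))

/-- Watson-type expansion of the integral along a ray, with an error bound uniform in `q`
and `Λ`. -/
lemma exists_bound_integral_rayIntegrand (hρ : 0 < ρ) (hμ : 1 ≤ μ)
    (hφ : DifferentiableOn ℂ φ (Metric.closedBall z₀ ρ))
    (hφ2 : ∀ z ∈ Metric.closedBall z₀ ρ, ‖φ z‖ ≤ 1 / 2) {a : ℂ} (ha : 0 < a.re) (S : ℕ)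
    {ω : ℂ} (hω : ‖ω‖ = 1) {R : ℝ} (hR : 0 < R) (hRρ : R ≤ ρ / 2) :
    ∃ C : ℝ, ∀ (q : ℂ → ℂ) (K : ℝ), DifferentiableOn ℂ q (Metric.closedBall z₀ ρ) →
      (∀ z ∈ Metric.closedBall z₀ ρ, ‖q z‖ ≤ K) → ∀ Λ : ℝ, 0 < Λ →
      ‖(∫ r in (0 : ℝ)..R, rayIntegrand z₀ μ φ q a ω Λ r) -
        ∑ s ∈ Finset.range S, (s.factorial : ℂ)⁻¹ * ω ^ s *
          (1 / μ * Complex.Gamma ((s + a) / μ) * (Λ : ℂ) ^ (-((s + a) / μ)) *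
            iteratedDeriv s (fun z => q z * (1 - φ z) ^ (-((s + a) / μ))) z₀)‖ ≤
        C * K * Λ ^ (-((S + a.re) / μ)) := by
  -- The first term comes from the Taylor remainder for `r ≤ R`, the sum from the Taylor polynomial
  -- for `r > R`.
  set C₀ : ℝ := 2 / ρ ^ S + ∑ s ∈ Finset.range S, (R / ρ) ^ s / R ^ S with hC₀
  have hSa : 0 < S + a.re := by positivity
  -- The second factor is the integral of `r^{S + Re a - 1} e^{-Λ r^μ / 2}` over the half-line,
  -- without its power of `Λ`.
  refine ⟨C₀ * ((1 / 2) ^ (-((S + a.re) / μ)) * (1 / μ) * Real.Gamma ((S + a.re) / μ)), ?_⟩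
  intro q K hq hK Λ hΛ
  have hK0 : 0 ≤ K := (norm_nonneg _).trans (hK z₀ (Metric.mem_closedBall_self hρ.le))
  have hre : ∀ s : ℕ, 0 < ((s : ℂ) + a).re := fun s => by
    simp only [Complex.add_re, Complex.natCast_re]; positivity
  set f : ℝ → ℂ → ℂ := fun u z => Complex.exp (u * φ z) * q z with hf
  have hfd : ∀ u, DiffContOnCl ℂ (f u) (Metric.ball z₀ ρ) := fun u =>
    diffContOnCl_ball_of_closedBall (((hφ.const_mul (u : ℂ)).cexp).mul hq)
  have hfM : ∀ u, 0 ≤ u → ∀ z ∈ Metric.sphere z₀ ρ, ‖f u z‖ ≤ K * Real.exp (u / 2) := by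
    intro u hu z hz
    have hz := Metric.sphere_subset_closedBall hz
    rw [hf, norm_mul, mul_comm]
    exact mul_le_mul (hK z hz) (norm_exp_ofReal_mul_le (hφ2 z hz) hu) (norm_nonneg _) hK0
  set T : ℕ → ℝ → ℂ := fun s r => Complex.exp (-((Λ * r ^ μ : ℝ) : ℂ)) *
    (r : ℂ) ^ ((s : ℂ) + a - 1) * iteratedDeriv s (f (Λ * r ^ μ)) z₀ with hT
  have hTint := fun s : ℕ => integral_iteratedDeriv_exp_mul hρ hμ hφ hφ2 hq (hre s) s hΛ
  set c : ℕ → ℂ := fun s => (s.factorial : ℂ)⁻¹ * ω ^ s with hc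
  have hTsum : IntegrableOn (fun r => ∑ s ∈ Finset.range S, c s * T s r) (Ioi 0) :=
    integrable_finsetSum _ fun s _ => (hTint s).1.const_mul _
  have hI1 : ∫ r in Ioi (0 : ℝ), ∑ s ∈ Finset.range S, c s * T s r =
      ∑ s ∈ Finset.range S, (s.factorial : ℂ)⁻¹ * ω ^ s *
          (1 / μ * Complex.Gamma ((s + a) / μ) * (Λ : ℂ) ^ (-((s + a) / μ)) *
            iteratedDeriv s (fun z => q z * (1 - φ z) ^ (-((s + a) / μ))) z₀) := by
    rw [integral_finsetSum _ fun s _ => (hTint s).1.const_mul _]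
    refine Finset.sum_congr rfl fun s _ => ?_
    rw [integral_const_mul, (hTint s).2]
  set h : ℝ → ℂ := rayIntegrand z₀ μ φ q a ω Λ with hh
  -- Extending the ray integrand by zero beyond `R` puts it on the same half-line as the Taylor
  -- terms, so that one pointwise bound suffices.
  have hhint : IntegrableOn ((Ioc 0 R).indicator h) (Ioi 0) := by
    have := integrableOn_rayIntegrand (μ := μ) hφ hφ2 hq hK hω ha hΛ.le (by linarith : R ≤ ρ)
    exact (this.integrable_indicator measurableSet_Ioc).integrableOn
  have hI2 : ∫ r in Ioi (0 : ℝ), (Ioc 0 R).indicator h r = ∫ r in (0 : ℝ)..R, h r := by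
    rw [setIntegral_indicator measurableSet_Ioc, intervalIntegral.integral_of_le hR.le,
      inter_eq_right.2 Ioc_subset_Ioi_self]
  rw [← hI1, ← hI2, ← integral_sub hhint hTsum]
  have hbint := (integrableOn_rpow_mul_exp_neg_mul_pow hμ hSa (half_pos hΛ)).const_mul (C₀ * K)
  have hpt : ∀ r ∈ Ioi (0 : ℝ), ‖(Ioc 0 R).indicator h r - ∑ s ∈ Finset.range S, c s * T s r‖ ≤
      C₀ * K * (r ^ (S + a.re - 1) * Real.exp (-(Λ / 2 * r ^ μ))) := by
    intro r hr
    have hr : 0 < r := hr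
    set u := Λ * r ^ μ with hu
    have hu0 : 0 ≤ u := by positivity
    have hexp : Real.exp (-u) * Real.exp (u / 2) = Real.exp (-(Λ / 2 * r ^ μ)) := by
      rw [← Real.exp_add]; congr 1; rw [hu]; ring
    have hnexp : ‖Complex.exp (-(u : ℂ))‖ = Real.exp (-u) := by
      rw [← Complex.ofReal_neg, Complex.norm_exp_ofReal]
    have hpow : r ^ (S + a.re - 1) = r ^ (a.re - 1) * r ^ S := by
      rw [← Real.rpow_natCast, ← Real.rpow_add hr]; congr 1; ring
    have hra : ‖(r : ℂ) ^ (a - 1)‖ = r ^ (a.re - 1) := by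
      rw [Complex.norm_cpow_eq_rpow_re_of_pos hr, Complex.sub_re, Complex.one_re]
    have hTr : ∀ s, c s * T s r = Complex.exp (-(u : ℂ)) * (r : ℂ) ^ (a - 1) *
        ((s.factorial : ℂ)⁻¹ * iteratedDeriv s (f u) z₀ * (r * ω) ^ s) := by
      intro s
      have : (r : ℂ) ^ ((s : ℂ) + a - 1) = (r : ℂ) ^ (a - 1) * (r : ℂ) ^ s := by
        rw [← Complex.cpow_natCast, ← Complex.cpow_add _ _ (by exact_mod_cast hr.ne')]
        congr 1; ring
      simp only [hT, hc]
      rw [this, mul_pow]; ring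
    have hr0 : 0 ≤ r ^ (a.re - 1) := by positivity
    have hsum0 : 0 ≤ ∑ s ∈ Finset.range S, (R / ρ) ^ s / R ^ S :=
      Finset.sum_nonneg fun s _ => by positivity
    rw [Finset.sum_congr rfl fun s _ => hTr s, ← Finset.mul_sum, ← hexp, hpow]
    by_cases hrR : r ≤ R
    · rw [indicator_of_mem (show r ∈ Ioc 0 R from ⟨hr, hrR⟩), hh, rayIntegrand_eq, ← hu, ← mul_sub, norm_mul, norm_mul,
        hnexp, hra]
      have hw : z₀ + r * ω - z₀ = r * ω := by ring
      have hnw : ‖(r * ω : ℂ)‖ = r := by simp [hω, abs_of_pos hr]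
      have := norm_sub_taylorSum_le hρ (hfd u) (hfM u hu0) S (z := z₀ + r * ω)
        (by rw [hw, hnw]; linarith)
      rw [hw, hnw] at this
      calc _ ≤ Real.exp (-u) * r ^ (a.re - 1) * (2 * (K * Real.exp (u / 2)) * (r / ρ) ^ S) := by
            gcongr
        _ = 2 / ρ ^ S * K * (r ^ (a.re - 1) * r ^ S * (Real.exp (-u) * Real.exp (u / 2))) := by
            rw [div_pow]; ring
        _ ≤ _ := by
            gcongr
            rw [hC₀]; linarith
    -- Beyond `R` only the Taylor polynomial is left. As `r / R > 1`, each `r^s` with `s < S` is at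
    -- most `R^s (r/R)^S`, so the tail satisfies a bound of the same shape.
    · have hrR : R < r := not_le.1 hrR
      rw [indicator_of_notMem (fun h => absurd h.2 (not_le.2 hrR)), zero_sub, norm_neg, norm_mul,
        norm_mul, hnexp, hra]
      have hterm : ∀ s ∈ Finset.range S, ‖(s.factorial : ℂ)⁻¹ * iteratedDeriv s (f u) z₀ *
          (r * ω) ^ s‖ ≤ K * Real.exp (u / 2) * r ^ S * ((R / ρ) ^ s / R ^ S) := by
        intro s hs
        have hsS := (Finset.mem_range.1 hs).le
        have hfac : (0 : ℝ) < s.factorial := by exact_mod_cast Nat.factorial_pos _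
        have h1 := Complex.norm_iteratedDeriv_le_of_forall_mem_sphere_norm_le s hρ (hfd u)
          (hfM u hu0)
        have h2 : (r / R) ^ s ≤ (r / R) ^ S :=
          pow_le_pow_right₀ ((one_le_div hR).2 hrR.le) hsS
        rw [norm_mul, norm_mul, norm_inv, Complex.norm_natCast, norm_pow, norm_mul, hω, mul_one,
          Complex.norm_real, Real.norm_of_nonneg hr.le]
        calc _ ≤ (s.factorial : ℝ)⁻¹ * (s.factorial * (K * Real.exp (u / 2)) / ρ ^ s) * r ^ s := by
              gcongr
          _ = K * Real.exp (u / 2) * (R / ρ) ^ s * (r / R) ^ s := by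
              rw [div_pow, div_pow]; field_simp
          _ ≤ K * Real.exp (u / 2) * (R / ρ) ^ s * (r / R) ^ S := by gcongr
          _ = _ := by rw [div_pow r]; ring
      calc _ ≤ Real.exp (-u) * r ^ (a.re - 1) *
            ∑ s ∈ Finset.range S, K * Real.exp (u / 2) * r ^ S * ((R / ρ) ^ s / R ^ S) := by
            gcongr
            exact norm_sum_le_of_le _ hterm
        _ = (∑ s ∈ Finset.range S, (R / ρ) ^ s / R ^ S) * K *
              (r ^ (a.re - 1) * r ^ S * (Real.exp (-u) * Real.exp (u / 2))) := by
            rw [← Finset.mul_sum]; ring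
        _ ≤ _ := by
            gcongr
            rw [hC₀]
            have : 0 ≤ 2 / ρ ^ S := by positivity
            linarith
  refine (norm_integral_le_of_norm_le hbint
    ((ae_restrict_iff' measurableSet_Ioi).2 (ae_of_all _ hpt))).trans (le_of_eq ?_)
  rw [integral_const_mul, integral_rpow_mul_exp_neg_mul_pow hμ hSa (half_pos hΛ),
    div_eq_mul_one_div Λ 2, Real.mul_rpow hΛ.le (by norm_num)]
  ring

end LocalExpansion

/-! ### Change of variables along the contour -/

lemma Ioc_ae_eq_Ioo_diff_finite (α β : ℝ) {E : Set ℝ} (hE : E.Finite) :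
    (Ioc α β : Set ℝ) =ᵐ[volume] (Ioo α β \ E : Set ℝ) := by
  refine Ioo_ae_eq_Ioc.symm.trans ?_
  exact (sdiff_null_ae_eq_self (hE.measure_zero _)).symm

lemma intervalIntegrable_iff_Ioo_diff_finite {f : ℝ → ℂ} {α β : ℝ} (h : α ≤ β) {E : Set ℝ}
    (hE : E.Finite) : IntervalIntegrable f volume α β ↔ IntegrableOn f (Ioo α β \ E) := by
  rw [intervalIntegrable_iff_integrableOn_Ioc_of_le h]
  exact integrableOn_congr_set_ae (Ioc_ae_eq_Ioo_diff_finite α β hE)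

lemma intervalIntegral_eq_Ioo_diff_finite (f : ℝ → ℂ) {α β : ℝ} (h : α ≤ β) {E : Set ℝ}
    (hE : E.Finite) : ∫ t in α..β, f t = ∫ t in Ioo α β \ E, f t := by
  rw [intervalIntegral.integral_of_le h]
  exact setIntegral_congr_set (Ioc_ae_eq_Ioo_diff_finite α β hE)

/-- Substitution of a monotone or antitone continuous function, differentiable off a finite set,
into a function with an integrable power singularity at the origin. -/
lemma integral_comp_mul_deriv_of_power_bound {f : ℝ → ℂ} {r : ℝ → ℝ} {α β ρ κ B : ℝ}
    (hαβ : α ≤ β) {E : Set ℝ} (hE : E.Finite) (hκ : 0 < κ)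
    (hfc : ContinuousOn f (Ioc 0 ρ)) (hfb : ∀ x ∈ Ioc 0 ρ, ‖f x‖ ≤ B * x ^ (κ - 1))
    (hr : ContinuousOn r (Icc α β)) (hr0 : ∀ t ∈ Icc α β, 0 ≤ r t) (hrρ : ∀ t ∈ Icc α β, r t < ρ)
    (hrpos : ∀ t ∈ Ioo α β, 0 < r t)
    (hmono : MonotoneOn r (Icc α β) ∨ AntitoneOn r (Icc α β))
    (hd : ∀ t ∈ Ioo α β \ E, DifferentiableAt ℝ r t)
    (hdc : ContinuousOn (deriv r) (Ioo α β \ E)) :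
    IntervalIntegrable (fun t => f (r t) * deriv r t) volume α β ∧
      ∫ t in α..β, f (r t) * deriv r t = (∫ x in (0 : ℝ)..r β, f x) - ∫ x in (0 : ℝ)..r α, f x := by
  have hmeas : MeasurableSet (Ioo α β \ E) := measurableSet_Ioo.diff hE.measurableSet
  have hρ : 0 < ρ := (hr0 α (left_mem_Icc.2 hαβ)).trans_lt (hrρ α (left_mem_Icc.2 hαβ))
  have hfint : IntervalIntegrable f volume 0 ρ := by
    have hg := (intervalIntegral.intervalIntegrable_rpow' (a := 0) (b := ρ)
      (by linarith : -1 < κ - 1)).const_mul B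
    rw [intervalIntegrable_iff_integrableOn_Ioc_of_le hρ.le] at hg ⊢
    exact hg.mono' (hfc.aestronglyMeasurable measurableSet_Ioc)
      ((ae_restrict_iff' measurableSet_Ioc).2 (ae_of_all _ hfb))
  have hpowd : ∀ t ∈ Ioo α β \ E,
      HasDerivAt (fun t => r t ^ κ) (deriv r t * κ * r t ^ (κ - 1)) t := fun t ht =>
    (hd t ht).hasDerivAt.rpow_const (Or.inl (hrpos t ht.1).ne')
  -- Integrability of `r'` would not suffice, as `r^{κ-1}` may blow up where `r` vanishes. But `r^κ`
  -- is monotone or antitone, so its derivative is integrable, and `|f(r) r'| ≤ (B/κ) |(r^κ)'|`.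
  have hpowint : IntervalIntegrable (deriv fun t => r t ^ κ) volume α β := by
    rcases hmono with h | h
    · refine MonotoneOn.intervalIntegrable_deriv ?_
      rw [uIcc_of_le hαβ]
      exact fun s hs t ht hst => Real.rpow_le_rpow (hr0 s hs) (h hs ht hst) hκ.le
    · have h2 : MonotoneOn (-fun t => r t ^ κ) (uIcc α β) := by
        rw [uIcc_of_le hαβ]
        exact fun s hs t ht hst => neg_le_neg (Real.rpow_le_rpow (hr0 t ht) (h hs ht hst) hκ.le)
      have := h2.intervalIntegrable_deriv.neg
      simpa [deriv.neg', Pi.neg_def] using this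
  have hmaps : MapsTo r (Ioo α β \ E) (Ioc 0 ρ) := fun t ht =>
    ⟨hrpos t ht.1, (hrρ t (Ioo_subset_Icc_self ht.1)).le⟩
  have hint : IntervalIntegrable (fun t => f (r t) * deriv r t) volume α β := by
    rw [intervalIntegrable_iff_Ioo_diff_finite hαβ hE]
    have hg : IntegrableOn (deriv fun t => r t ^ κ) (Ioo α β \ E) := by
      rw [intervalIntegrable_iff_integrableOn_Ioc_of_le hαβ] at hpowint
      exact hpowint.mono_set (sdiff_subset.trans Ioo_subset_Ioc_self)
    refine (hg.norm.const_mul (B / κ)).mono' (ContinuousOn.aestronglyMeasurable ?_ hmeas) ?_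
    · refine (hfc.comp (hr.mono (sdiff_subset.trans Ioo_subset_Icc_self)) hmaps).mul ?_
      exact Complex.continuous_ofReal.comp_continuousOn hdc
    · refine (ae_restrict_iff' hmeas).2 (ae_of_all _ fun t ht => ?_)
      have h1 := hfb _ (hmaps ht)
      have h2 : 0 ≤ r t ^ (κ - 1) := Real.rpow_nonneg (hmaps ht).1.le _
      rw [(hpowd t ht).deriv, norm_mul, Complex.norm_real, norm_mul, norm_mul,
        Real.norm_of_nonneg h2, Real.norm_of_nonneg hκ.le]
      calc _ ≤ B * r t ^ (κ - 1) * ‖deriv r t‖ := by gcongr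
        _ = _ := by field_simp
  refine ⟨hint, ?_⟩
  set F : ℝ → ℂ := fun x => ∫ y in (0 : ℝ)..x, f y with hF
  have hFc : ContinuousOn F (Icc 0 ρ) := by
    have := intervalIntegral.continuousOn_primitive_interval' hfint left_mem_uIcc
    rwa [uIcc_of_le hρ.le] at this
  have hFd : ∀ x ∈ Ioo 0 ρ, HasDerivAt F (f x) x := by
    intro x hx
    have hfo : ContinuousOn f (Ioo 0 ρ) := hfc.mono Ioo_subset_Ioc_self
    refine intervalIntegral.integral_hasDerivAt_right ?_
      (hfo.stronglyMeasurableAtFilter isOpen_Ioo x hx) (hfo.continuousAt (isOpen_Ioo.mem_nhds hx))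
    refine hfint.mono_set ?_
    rw [uIcc_of_le hx.1.le, uIcc_of_le hρ.le]
    exact Icc_subset_Icc_right hx.2.le
  -- The primitive is continuous up to 0, so `r` may vanish at an endpoint, and the fundamental
  -- theorem tolerates the finite set `E`.
  refine integral_eq_of_hasDerivAt_off_countable_of_le (fun t => F (r t)) _ hαβ hE.countable
    (hFc.comp hr fun t ht => ⟨hr0 t ht, (hrρ t ht).le⟩) (fun t ht => ?_) hint
  have := (hFd (r t) ⟨hrpos t ht.1, hrρ t (Ioo_subset_Icc_self ht.1)⟩).scomp t (hd t ht).hasDerivAt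
  rw [Complex.real_smul, mul_comm] at this
  exact this

/-- This is what makes the ray a direction of steepest descent: to leading order `p(z₀) - p(z)` is
real and positive on it. -/
lemma mul_exp_bisectingAngle_pow {p₀ : ℂ} {μ : ℕ} (hμ : 1 ≤ μ) (l : ℤ) :
    p₀ * Complex.exp (Complex.I * bisectingAngle p₀ μ l) ^ μ = ‖p₀‖ := by
  have hμc : (μ : ℂ) ≠ 0 := by exact_mod_cast (by omega : μ ≠ 0)
  rw [← Complex.exp_nat_mul]
  have : (μ : ℂ) * (Complex.I * bisectingAngle p₀ μ l) =
      -(p₀.arg * Complex.I) + l * (2 * Real.pi * Complex.I) := by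
    rw [bisectingAngle]; push_cast; field_simp
  rw [this, Complex.exp_add, Complex.exp_int_mul_two_pi_mul_I, mul_one]
  nth_rewrite 1 [← Complex.norm_mul_exp_arg_mul_I p₀]
  rw [mul_assoc, ← Complex.exp_add, add_neg_cancel, Complex.exp_zero, mul_one]

/-- The part of the contour integral over a parameter interval on which the contour runs along a
ray in a steepest-descent direction. -/
lemma integral_perronIntegrand_along_ray {z₀ : ℂ} {c : ℝ → ℂ} {p q φ : ℂ → ℂ} {μ : ℕ} {p₀ a : ℂ}
    {ϑ : ℝ → ℝ} {l : ℤ} {ρ K N α β : ℝ} {E : Set ℝ} (hμ : 1 ≤ μ) (ha : 0 < a.re)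
    (hφ : DifferentiableOn ℂ φ (Metric.closedBall z₀ ρ))
    (hφ2 : ∀ z ∈ Metric.closedBall z₀ ρ, ‖φ z‖ ≤ 1 / 2)
    (hq : DifferentiableOn ℂ q (Metric.closedBall z₀ ρ))
    (hK : ∀ z ∈ Metric.closedBall z₀ ρ, ‖q z‖ ≤ K) (hN : 0 < N)
    (hloc : ∀ z ∈ Metric.closedBall z₀ ρ, p z = p z₀ - p₀ * (z - z₀) ^ μ * (1 - φ z))
    (hαβ : α ≤ β) (hE : E.Finite) (hc : ContinuousOn c (Icc α β))
    (hd : ∀ t ∈ Ioo α β \ E, DifferentiableAt ℝ c t) (hdc : ContinuousOn (deriv c) (Ioo α β \ E))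
    (hne : ∀ t ∈ Ioo α β, c t ≠ z₀) (hcρ : ∀ t ∈ Icc α β, ‖c t - z₀‖ < ρ)
    (hmono : MonotoneOn (fun t => ‖c t - z₀‖) (Icc α β) ∨
      AntitoneOn (fun t => ‖c t - z₀‖) (Icc α β))
    (hray : ∀ t ∈ Icc α β,
      c t = z₀ + ‖c t - z₀‖ * Complex.exp (Complex.I * bisectingAngle p₀ μ l))
    (hϑ : ∀ t ∈ Ioo α β, ϑ t = bisectingAngle p₀ μ l) :
    IntervalIntegrable (perronIntegrand c z₀ ϑ a p q N) volume α β ∧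
      ∫ t in α..β, perronIntegrand c z₀ ϑ a p q N t =
        Complex.exp (N * p z₀) * Complex.exp (Complex.I * bisectingAngle p₀ μ l * a) *
          ((∫ x in (0 : ℝ)..‖c β - z₀‖, rayIntegrand z₀ μ φ q a
              (Complex.exp (Complex.I * bisectingAngle p₀ μ l)) (N * ‖p₀‖) x) -
            ∫ x in (0 : ℝ)..‖c α - z₀‖, rayIntegrand z₀ μ φ q a
              (Complex.exp (Complex.I * bisectingAngle p₀ μ l)) (N * ‖p₀‖) x) := by
  set θ := bisectingAngle p₀ μ l with hθ
  set ω := Complex.exp (Complex.I * θ) with hω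
  have hω0 : ω ≠ 0 := Complex.exp_ne_zero _
  have hω1 : ‖ω‖ = 1 := by rw [hω, mul_comm, Complex.norm_exp_ofReal_mul_I]
  set r : ℝ → ℝ := fun t => ‖c t - z₀‖ with hr
  set f := rayIntegrand z₀ μ φ q a ω (N * ‖p₀‖) with hf
  have hrc : ContinuousOn r (Icc α β) := (hc.sub continuousOn_const).norm
  -- On the ray `r = Re ((c - z₀) ω⁻¹)`, which is linear in `c`; hence `r'` inherits existence and
  -- continuity from `c'`.
  have hrd : ∀ t ∈ Ioo α β \ E, HasDerivAt r (deriv c t * ω⁻¹).re t := by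
    intro t ht
    have h1 : HasDerivAt (fun t => (c t - z₀) * ω⁻¹) (deriv c t * ω⁻¹) t :=
      ((hd t ht).hasDerivAt.sub_const z₀).mul_const _
    have h2 : HasDerivAt (fun t => ((c t - z₀) * ω⁻¹).re) (deriv c t * ω⁻¹).re t :=
      (Complex.reCLM.hasFDerivAt.comp_hasDerivAt t h1)
    refine h2.congr_of_eventuallyEq ?_
    filter_upwards [Icc_mem_nhds ht.1.1 ht.1.2] with s hs
    have h3 : (c s - z₀) * ω⁻¹ = (r s : ℂ) := by
      have := hray s hs
      rw [← eq_sub_iff_add_eq'.2 this.symm, mul_inv_cancel_right₀ hω0]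
    rw [h3, Complex.ofReal_re]
  have hdr : ∀ t ∈ Ioo α β \ E, deriv c t = deriv r t * ω := by
    intro t ht
    have h1 : HasDerivAt (fun t => z₀ + (r t : ℂ) * ω) (deriv r t * ω) t :=
      ((hrd t ht).differentiableAt.hasDerivAt.ofReal_comp.mul_const ω).const_add z₀
    refine (h1.congr_of_eventuallyEq ?_).deriv
    filter_upwards [Icc_mem_nhds ht.1.1 ht.1.2] with s hs using hray s hs
  have hrdc : ContinuousOn (deriv r) (Ioo α β \ E) := by
    refine ContinuousOn.congr (f := fun t => (deriv c t * ω⁻¹).re) ?_ fun t ht => (hrd t ht).deriv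
    exact Complex.continuous_re.comp_continuousOn (hdc.mul continuousOn_const)
  have hrpos : ∀ t ∈ Ioo α β, 0 < r t := fun t ht => norm_pos_iff.2 (sub_ne_zero.2 (hne t ht))
  have hΛ : 0 ≤ N * ‖p₀‖ := by positivity
  obtain ⟨hI, hval⟩ := integral_comp_mul_deriv_of_power_bound (f := f) (B := K) hαβ hE ha
    (continuousOn_rayIntegrand hφ hq hω1 a _)
    (fun x hx => norm_rayIntegrand_le hφ2 hK hω1 a hΛ hx) hrc (fun t _ => norm_nonneg _) hcρ hrpos
    hmono (fun t ht => (hrd t ht).differentiableAt) hrdc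
  have hmeas : MeasurableSet (Ioo α β \ E) := measurableSet_Ioo.diff hE.measurableSet
  have heq : ∀ t ∈ Ioo α β \ E,
      Complex.exp (N * p z₀) * Complex.exp (Complex.I * θ * a) * (f (r t) * deriv r t) =
        perronIntegrand c z₀ ϑ a p q N t := by
    intro t ht
    have htI := Ioo_subset_Icc_self ht.1
    have hct : c t = z₀ + (r t : ℂ) * ω := hray t htI
    have hball : c t ∈ Metric.closedBall z₀ ρ := by
      rw [mem_closedBall_iff_norm]; exact (hcρ t htI).le
    have hp : (N : ℂ) * p (c t) = N * p z₀ +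
        -(((N * ‖p₀‖ : ℝ) : ℂ) * (r t : ℂ) ^ μ * (1 - φ (z₀ + (r t : ℂ) * ω))) := by
      rw [hloc _ hball, hct, add_sub_cancel_left, mul_pow, Complex.ofReal_mul,
        ← mul_exp_bisectingAngle_pow (p₀ := p₀) hμ l]
      ring
    -- The factor `ω` of `dz = ω dr` raises the exponent of the phase from `a - 1` to `a`.
    have hexp : Complex.exp (Complex.I * θ * a) =
        Complex.exp (Complex.I * θ * (a - 1)) * ω := by
      rw [hω, ← Complex.exp_add]; congr 1; ring
    have hn : ‖c t - z₀‖ = r t := rfl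
    rw [perronIntegrand, branchPow, hdr t ht, hp, Complex.exp_add, hϑ t ht.1, hexp, hf,
      rayIntegrand, hn, ← hct]
    ring
  refine ⟨?_, ?_⟩
  · rw [intervalIntegrable_iff_Ioo_diff_finite hαβ hE]
    refine IntegrableOn.congr_fun ?_ heq hmeas
    exact ((intervalIntegrable_iff_Ioo_diff_finite hαβ hE).1 hI).const_mul _
  · rw [intervalIntegral_eq_Ioo_diff_finite _ hαβ hE, ← setIntegral_congr_fun hmeas heq,
      ← intervalIntegral_eq_Ioo_diff_finite _ hαβ hE, intervalIntegral.integral_const_mul, hval]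

/-! ### The contribution away from the saddle point -/

/-- Raise `x ≤ e^x` at `x = Nη/κ` to the power `κ`. The estimate holds for all `N > 0`, so no lower
bound on `N` enters the theorem. -/
lemma exp_neg_mul_le_rpow {κ η N : ℝ} (hκ : 0 < κ) (hη : 0 < η) (hN : 0 < N) :
    Real.exp (-(N * η)) ≤ (η / κ) ^ (-κ) * N ^ (-κ) := by
  have h1 : N * (η / κ) ≤ Real.exp (N * (η / κ)) := by
    have := Real.add_one_le_exp (N * (η / κ)); linarith
  have h2 : (N * (η / κ)) ^ κ ≤ Real.exp (N * η) := by
    calc _ ≤ Real.exp (N * (η / κ)) ^ κ := by gcongr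
      _ = _ := by rw [← Real.exp_mul]; congr 1; field_simp
  have h3 : 0 < (N * (η / κ)) ^ κ := by positivity
  rw [mul_comm (_ ^ _), ← Real.mul_rpow hN.le (by positivity), Real.rpow_neg (by positivity), Real.exp_neg]
  exact inv_anti₀ h3 h2

/-- The part of the contour integral away from the saddle point is negligible. -/
lemma exists_bound_integral_perronIntegrand_away {z₀ : ℂ} {c : ℝ → ℂ} {p : ℂ → ℂ} {D : Set ℂ}
    {ϑ : ℝ → ℝ} {α β κ : ℝ} (a : ℂ) (hκ : 0 < κ) (hαβ : α ≤ β) (hc : ContinuousOn c (Icc α β))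
    (hci : IntervalIntegrable (deriv c) volume α β) (hp : DifferentiableOn ℂ p D)
    (hcD : ∀ t ∈ Icc α β, c t ∈ D) (hne : ∀ t ∈ Icc α β, c t ≠ z₀)
    (hmax : ∀ t ∈ Icc α β, (p (c t)).re < (p z₀).re) (hϑ : ContinuousOn ϑ (Icc α β)) :
    ∃ C : ℝ, ∀ (q : ℂ → ℂ) (K : ℝ), ContinuousOn (fun t => q (c t)) (Icc α β) →
      (∀ t ∈ Icc α β, ‖q (c t)‖ ≤ K) → ∀ N : ℝ, 0 < N →
      IntervalIntegrable (perronIntegrand c z₀ ϑ a p q N) volume α β ∧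
      ‖∫ t in α..β, perronIntegrand c z₀ ϑ a p q N t‖ ≤
        ‖Complex.exp (N * p z₀)‖ * (C * K * N ^ (-κ)) := by
  have hpc : ContinuousOn (fun t => p (c t)) (Icc α β) := hp.continuousOn.comp hc hcD
  have hbr : ContinuousOn (branchPow c z₀ ϑ (a - 1)) (Icc α β) := by
    unfold branchPow
    refine ContinuousOn.mul (fun t ht => ?_) ?_
    · have h1 : ContinuousWithinAt (fun t => ‖c t - z₀‖) (Icc α β) t :=
        ((hc.sub continuousOn_const).norm) t ht
      have h2 : ‖c t - z₀‖ ≠ 0 := norm_ne_zero_iff.2 (sub_ne_zero.2 (hne t ht))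
      exact ContinuousAt.comp_continuousWithinAt (f := fun t => ‖c t - z₀‖)
        (g := fun x : ℝ => (x : ℂ) ^ (a - 1))
        (Complex.continuousAt_ofReal_cpow_const _ _ (Or.inr h2)) h1
    · have h := Complex.continuous_ofReal.comp_continuousOn hϑ
      exact ((continuousOn_const.mul h).mul continuousOn_const).cexp
  obtain ⟨B, hB⟩ := isCompact_Icc.exists_bound_of_continuousOn hbr
  obtain ⟨tm, htm, hm⟩ := isCompact_Icc.exists_isMaxOn (nonempty_Icc.2 hαβ)
    (Complex.continuous_re.comp_continuousOn hpc)
  -- The maximum of `Re p` on this compact piece is attained, so the strict inequality becomes a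
  -- uniform gap.
  set η := (p z₀).re - (p (c tm)).re with hη
  have hη0 : 0 < η := sub_pos.2 (hmax tm htm)
  have hB0 : 0 ≤ B := (norm_nonneg _).trans (hB tm htm)
  set L := ∫ t in α..β, ‖deriv c t‖ with hL
  have hL0 : 0 ≤ L := intervalIntegral.integral_nonneg hαβ fun t _ => norm_nonneg _
  refine ⟨B * (η / κ) ^ (-κ) * L, fun q K hqc hK N hN => ?_⟩
  have hK0 : 0 ≤ K := (norm_nonneg _).trans (hK tm htm)
  have hpref : ContinuousOn (fun t => Complex.exp (N * p (c t)) * branchPow c z₀ ϑ (a - 1) t *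
      q (c t)) (Icc α β) := (((continuousOn_const.mul hpc).cexp).mul hbr).mul hqc
  refine ⟨?_, ?_⟩
  · have := hci.continuousOn_mul (by rwa [uIcc_of_le hαβ])
    exact this
  · have hbd : ∀ t ∈ Ioc α β, ‖perronIntegrand c z₀ ϑ a p q N t‖ ≤
        ‖Complex.exp (N * p z₀)‖ * Real.exp (-(N * η)) * B * K * ‖deriv c t‖ := by
      intro t ht
      have ht := Ioc_subset_Icc_self ht
      have h1 : ‖Complex.exp (N * p (c t))‖ ≤
          ‖Complex.exp (N * p z₀)‖ * Real.exp (-(N * η)) := by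
        rw [Complex.norm_exp, Complex.norm_exp, ← Real.exp_add, Complex.re_ofReal_mul,
          Complex.re_ofReal_mul]
        have : (p (c t)).re ≤ (p (c tm)).re := hm ht
        gcongr
        rw [hη]; nlinarith
      rw [perronIntegrand, norm_mul, norm_mul, norm_mul]
      have h2 := hB t ht
      have h3 := hK t ht
      gcongr
    refine (intervalIntegral.norm_integral_le_of_norm_le hαβ (ae_of_all _ hbd)
      (hci.norm.const_mul _)).trans ?_
    rw [intervalIntegral.integral_const_mul, ← hL]
    calc _ ≤ ‖Complex.exp (N * p z₀)‖ * ((η / κ) ^ (-κ) * N ^ (-κ)) * B * K * L := by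
          gcongr
          exact exp_neg_mul_le_rpow hκ hη0 hN
      _ = _ := by ring

/-! ### Coefficients and assembly -/

/-- The part `-arg p₀ / μ` of the angle, raised to `s + a`, supplies the phase that turns
`|p₀|^{-(s+a)/μ}` into the principal power of `p₀`; only the root of unity part, depending on `k`,
is left over. -/
lemma perronCoeff_mul_exp {z₀ : ℂ} {q φ : ℂ → ℂ} {μ : ℕ} {p₀ a : ℂ} (hp₀ : p₀ ≠ 0)
    {N : ℝ} (hN : 0 < N) (k : ℤ) (s : ℕ) :
    Complex.exp (Complex.I * bisectingAngle p₀ μ k * a) * ((s.factorial : ℂ)⁻¹ *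
      Complex.exp (Complex.I * bisectingAngle p₀ μ k) ^ s *
        (1 / μ * Complex.Gamma ((s + a) / μ) * ((N * ‖p₀‖ : ℝ) : ℂ) ^ (-((s + a) / μ)) *
          iteratedDeriv s (fun z => q z * (1 - φ z) ^ (-((s + a) / μ))) z₀)) =
      Complex.Gamma (((s : ℂ) + a) / (μ : ℂ)) * (perronCoeff μ p₀ a q φ z₀ s *
        Complex.exp (2 * Real.pi * Complex.I * k * ((s : ℂ) + a) / (μ : ℂ))) /
          (N : ℂ) ^ (((s : ℂ) + a) / (μ : ℂ)) := by
  have hpn : (‖p₀‖ : ℂ) ≠ 0 := by simpa using hp₀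
  set x : ℂ := ((s : ℂ) + a) / μ with hx
  have h1 : ((N * ‖p₀‖ : ℝ) : ℂ) ^ (-x) = ((N : ℂ) ^ x)⁻¹ * (‖p₀‖ : ℂ) ^ (-x) := by
    rw [Complex.ofReal_mul, Complex.mul_cpow_ofReal_nonneg hN.le (norm_nonneg _), Complex.cpow_neg]
  have h2 : p₀ ^ (-x) = (‖p₀‖ : ℂ) ^ (-x) * Complex.exp (-(p₀.arg * Complex.I * x)) := by
    rw [Complex.cpow_def_of_ne_zero hp₀, Complex.cpow_def_of_ne_zero hpn, ← Complex.exp_add,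
      Complex.log, Complex.ofReal_log (norm_nonneg _)]
    congr 1; ring
  have h3 : Complex.exp (Complex.I * bisectingAngle p₀ μ k * a) *
      Complex.exp (Complex.I * bisectingAngle p₀ μ k) ^ s =
      Complex.exp (-(p₀.arg * Complex.I * x)) *
        Complex.exp (2 * Real.pi * Complex.I * k * ((s : ℂ) + a) / (μ : ℂ)) := by
    rw [← Complex.exp_nat_mul, ← Complex.exp_add, ← Complex.exp_add, bisectingAngle]
    congr 1
    rw [hx]; push_cast; ring
  have h4 : -((s : ℂ) + a) / (μ : ℂ) = -x := by rw [hx, neg_div]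
  rw [perronCoeff, h4, h1, h2, one_div, one_div, mul_inv]
  calc _ = (Complex.exp (Complex.I * bisectingAngle p₀ μ k * a) *
      Complex.exp (Complex.I * bisectingAngle p₀ μ k) ^ s) * ((s.factorial : ℂ)⁻¹ * ((μ : ℂ)⁻¹ *
        Complex.Gamma x * (((N : ℂ) ^ x)⁻¹ * (‖p₀‖ : ℂ) ^ (-x)) *
          iteratedDeriv s (fun z => q z * (1 - φ z) ^ (-x)) z₀)) := by ring
    _ = _ := by rw [h3]; ring

theorem corollary6p2
    -- the neighbourhood, the contour and the holomorphic function `p` on a domain `D`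
    (z₀ : ℂ) (nb : Set ℂ) (hnb : nb ∈ 𝓝 z₀)
    (c : ℝ → ℂ) (hc : IsContour c)
    (D : Set ℂ) (hDo : IsOpen D) (hDc : IsConnected D) (hD : nb ∪ c '' Icc 0 1 ⊆ D)
    (p : ℂ → ℂ) (hp : DifferentiableOn ℂ p D)
    -- the local form of the (thus non-constant) function `p` at `z₀`
    (μ : ℕ) (hμ : 1 ≤ μ) (p₀ : ℂ) (hp₀ : p₀ ≠ 0)
    (φ : ℂ → ℂ) (hφ : DifferentiableOn ℂ φ nb) (hφ₀ : φ z₀ = 0)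
    (hloc : ∀ z ∈ nb, p z = p z₀ - p₀ * (z - z₀) ^ μ * (1 - φ z))
    -- the contour passes through `z₀` along two bisecting lines, and `z₁ = c 0`, `z₂ = c 1`
    (hends : c 0 ≠ c 1) (t₀ : ℝ) (k₁ k₂ : ℤ)
    (hpass : PassesAlongRays c z₀ t₀ (bisectingAngle p₀ μ k₁) (bisectingAngle p₀ μ k₂))
    (hmax : ∀ z ∈ c '' Icc 0 1, z ≠ z₀ → (p z).re < (p z₀).re)
    -- the exponent and the branch of the power
    (a : ℂ) (ha : 0 < a.re)
    (ϑ : ℝ → ℝ)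
    (hϑ : IsArgAlong c z₀ t₀ (bisectingAngle p₀ μ k₁) (bisectingAngle p₀ μ k₂) ϑ)
    (S : ℕ) :
    ∃ C : ℝ, ∀ (D' : Set ℂ) (q : ℂ → ℂ) (K : ℝ),
      IsOpen D' → IsConnected D' → nb ∪ c '' Icc 0 1 ⊆ D' → DifferentiableOn ℂ q D' →
      (∀ z ∈ nb ∪ c '' Icc 0 1, ‖q z‖ ≤ K) →
      ∀ N : ℝ, 0 < N →
        IntervalIntegrable (perronIntegrand c z₀ ϑ a p q N) volume 0 1 ∧
        ∃ err : ℂ, ‖err‖ ≤ C * (K / N ^ (((S : ℝ) + a.re) / (μ : ℝ))) ∧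
          ∫ t in (0 : ℝ)..1, perronIntegrand c z₀ ϑ a p q N t =
            Complex.exp (N * p z₀) *
              (∑ s ∈ Finset.range S,
                Complex.Gamma (((s : ℂ) + a) / (μ : ℂ)) *
                  (perronCoeff μ p₀ a q φ z₀ s *
                    (Complex.exp (2 * Real.pi * Complex.I * k₂ * ((s : ℂ) + a) / (μ : ℂ)) -
                      Complex.exp (2 * Real.pi * Complex.I * k₁ * ((s : ℂ) + a) / (μ : ℂ)))) /
                  (N : ℂ) ^ (((s : ℂ) + a) / (μ : ℂ))
                + err) := by
  obtain ⟨E, hE, hEd, hEc⟩ := hc.piecewise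
  obtain ⟨ht0, ht1⟩ := hpass.mem
  have hct₀ : c t₀ = z₀ := (hpass.eq_iff t₀ ⟨ht0.le, ht1.le⟩).2 rfl
  -- a disc on which `φ` is small
  obtain ⟨ρ, hρ, hρsub⟩ : ∃ ρ > 0, Metric.closedBall z₀ ρ ⊆ nb ∩ {z | ‖φ z‖ ≤ 1 / 2} := by
    refine Metric.nhds_basis_closedBall.mem_iff.1 (inter_mem hnb ?_)
    have h1 : Tendsto (fun z => ‖φ z‖) (𝓝 z₀) (𝓝 0) := by
      simpa [hφ₀] using (hφ.differentiableAt hnb).continuousAt.norm.tendsto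
    exact (h1.eventually (ge_mem_nhds (by norm_num : (0 : ℝ) < 1 / 2)))
  have hρnb : Metric.closedBall z₀ ρ ⊆ nb := fun z hz => (hρsub hz).1
  have hφ2 : ∀ z ∈ Metric.closedBall z₀ ρ, ‖φ z‖ ≤ 1 / 2 := fun z hz => (hρsub hz).2
  have hφρ := hφ.mono hρnb
  obtain ⟨ε, hε, hεc⟩ : ∃ ε > 0, ∀ t, |t - t₀| < ε → ‖c t - z₀‖ < ρ / 2 := by
    have h1 : ContinuousAt c t₀ := hc.continuousOn.continuousAt (Icc_mem_nhds ht0 ht1)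
    obtain ⟨ε, hε, h⟩ := Metric.continuousAt_iff.1 h1 (ρ / 2) (half_pos hρ)
    refine ⟨ε, hε, fun t ht => ?_⟩
    have := h (x := t) (by rwa [Real.dist_eq])
    rwa [hct₀, dist_eq_norm] at this
  -- parameters `α < t₀ < β` cutting out the two ray segments
  obtain ⟨α, hα0, hαt, hαc, hαm, hαr, hαϑ⟩ : ∃ α, 0 < α ∧ α < t₀ ∧
      (∀ t ∈ Icc α t₀, ‖c t - z₀‖ < ρ / 2) ∧ AntitoneOn (fun t => ‖c t - z₀‖) (Icc α t₀) ∧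
      (∀ t ∈ Icc α t₀,
        c t = z₀ + ‖c t - z₀‖ * Complex.exp (Complex.I * bisectingAngle p₀ μ k₁)) ∧
      ∀ t ∈ Ioo α t₀, ϑ t = bisectingAngle p₀ μ k₁ := by
    obtain ⟨δ, hδ, hm, hr⟩ := hpass.approach
    obtain ⟨l, hl, hlϑ⟩ := mem_nhdsLT_iff_exists_Ioo_subset.1 hϑ.left_eq
    have hl : l < t₀ := hl
    -- The four lower bounds secure, in turn, `α > 0`, the disc of radius `ρ / 2`, the ray, and the
    -- constancy of `ϑ`.
    set α := max (max (t₀ / 2) (t₀ - ε / 2)) (max (t₀ - δ) l) with hα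
    have hsub : Icc α t₀ ⊆ Icc (t₀ - δ) t₀ :=
      Icc_subset_Icc_left ((le_max_left _ _).trans (le_max_right _ _))
    have h1 : t₀ / 2 ≤ α := (le_max_left _ _).trans (le_max_left _ _)
    have h2 : t₀ - ε / 2 ≤ α := (le_max_right _ _).trans (le_max_left _ _)
    have h3 : l ≤ α := (le_max_right _ _).trans (le_max_right _ _)
    refine ⟨α, by linarith, ?_, fun t ht => hεc t ?_, hm.mono hsub, fun t ht => hr t (hsub ht),
      fun t ht => hlϑ ⟨h3.trans_lt ht.1, ht.2⟩⟩
    · refine max_lt (max_lt ?_ ?_) (max_lt ?_ hl) <;> linarith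
    · rw [abs_lt]; constructor <;> linarith [ht.1, ht.2]
  obtain ⟨β, hβt, hβ1, hβc, hβm, hβr, hβϑ⟩ : ∃ β, t₀ < β ∧ β < 1 ∧
      (∀ t ∈ Icc t₀ β, ‖c t - z₀‖ < ρ / 2) ∧ MonotoneOn (fun t => ‖c t - z₀‖) (Icc t₀ β) ∧
      (∀ t ∈ Icc t₀ β,
        c t = z₀ + ‖c t - z₀‖ * Complex.exp (Complex.I * bisectingAngle p₀ μ k₂)) ∧
      ∀ t ∈ Ioo t₀ β, ϑ t = bisectingAngle p₀ μ k₂ := by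
    obtain ⟨δ, hδ, hm, hr⟩ := hpass.leave
    obtain ⟨l, hl, hlϑ⟩ := mem_nhdsGT_iff_exists_Ioo_subset.1 hϑ.right_eq
    have hl : t₀ < l := hl
    set β := min (min ((t₀ + 1) / 2) (t₀ + ε / 2)) (min (t₀ + δ) l) with hβ
    have hsub : Icc t₀ β ⊆ Icc t₀ (t₀ + δ) :=
      Icc_subset_Icc_right ((min_le_right _ _).trans (min_le_left _ _))
    have h1 : β ≤ (t₀ + 1) / 2 := (min_le_left _ _).trans (min_le_left _ _)
    have h2 : β ≤ t₀ + ε / 2 := (min_le_left _ _).trans (min_le_right _ _)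
    have h3 : β ≤ l := (min_le_right _ _).trans (min_le_right _ _)
    refine ⟨β, ?_, by linarith, fun t ht => hεc t ?_, hm.mono hsub, fun t ht => hr t (hsub ht),
      fun t ht => hlϑ ⟨ht.1, ht.2.trans_le h3⟩⟩
    · refine lt_min (lt_min ?_ ?_) (lt_min ?_ hl) <;> linarith
    · rw [abs_lt]; constructor <;> linarith [ht.1, ht.2]
  have hne : ∀ t ∈ Icc (0 : ℝ) 1, t ≠ t₀ → c t ≠ z₀ := fun t ht h h' =>
    h ((hpass.eq_iff t ht).1 h')
  set κ : ℝ := ((S : ℝ) + a.re) / μ with hκdef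
  have hκ : 0 < κ := by
    have : (0 : ℝ) < μ := by exact_mod_cast hμ
    positivity
  have hαI : α ∈ Icc (0 : ℝ) 1 := ⟨hα0.le, by linarith⟩
  have hβI : β ∈ Icc (0 : ℝ) 1 := ⟨by linarith, hβ1.le⟩
  have hs1 : Icc 0 α ⊆ Icc (0 : ℝ) 1 := Icc_subset_Icc_right hαI.2
  have hs2 : Icc α t₀ ⊆ Icc (0 : ℝ) 1 := Icc_subset_Icc hαI.1 ht1.le
  have hs3 : Icc t₀ β ⊆ Icc (0 : ℝ) 1 := Icc_subset_Icc ht0.le hβI.2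
  have hs4 : Icc β 1 ⊆ Icc (0 : ℝ) 1 := Icc_subset_Icc_left hβI.1
  have hn1 : ∀ t ∈ Icc 0 α, c t ≠ z₀ := fun t ht => hne t (hs1 ht) (by linarith [ht.2])
  have hn4 : ∀ t ∈ Icc β 1, c t ≠ z₀ := fun t ht => hne t (hs4 ht) (by linarith [ht.1])
  have hci : ∀ x ∈ Icc (0 : ℝ) 1, ∀ y ∈ Icc (0 : ℝ) 1,
      IntervalIntegrable (deriv c) volume x y := fun x hx y hy =>
    hc.finite_length.mono_set (by
      rw [uIcc_of_le zero_le_one]; exact (convex_Icc 0 1).ordConnected.uIcc_subset hx hy)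
  obtain ⟨C1, hC1⟩ := exists_bound_integral_perronIntegrand_away (p := p) (D := D) (ϑ := ϑ) a hκ
    hα0.le (hc.continuousOn.mono hs1) (hci 0 (by simp) α hαI) hp
    (fun t ht => hD (Or.inr (mem_image_of_mem c (hs1 ht)))) hn1
    (fun t ht => hmax _ (mem_image_of_mem c (hs1 ht)) (hn1 t ht))
    (hϑ.continuousOn_left.mono fun t ht => ⟨ht.1, ht.2.trans_lt hαt⟩)
  obtain ⟨C4, hC4⟩ := exists_bound_integral_perronIntegrand_away (p := p) (D := D) (ϑ := ϑ) a hκ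
    hβ1.le (hc.continuousOn.mono hs4) (hci β hβI 1 (by simp)) hp
    (fun t ht => hD (Or.inr (mem_image_of_mem c (hs4 ht)))) hn4
    (fun t ht => hmax _ (mem_image_of_mem c (hs4 ht)) (hn4 t ht))
    (hϑ.continuousOn_right.mono fun t ht => ⟨hβt.trans_le ht.1, ht.2⟩)
  have hω : ∀ x : ℝ, ‖Complex.exp (Complex.I * x)‖ = 1 := fun x => by
    rw [mul_comm, Complex.norm_exp_ofReal_mul_I]
  have hRα : 0 < ‖c α - z₀‖ := norm_pos_iff.2 (sub_ne_zero.2 (hn1 α ⟨hα0.le, le_rfl⟩))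
  have hRβ : 0 < ‖c β - z₀‖ := norm_pos_iff.2 (sub_ne_zero.2 (hn4 β ⟨le_rfl, hβ1.le⟩))
  obtain ⟨C2, hC2⟩ := exists_bound_integral_rayIntegrand hρ hμ hφρ hφ2 ha S
    (hω (bisectingAngle p₀ μ k₁)) hRα (hαc α ⟨le_rfl, hαt.le⟩).le
  obtain ⟨C3, hC3⟩ := exists_bound_integral_rayIntegrand hρ hμ hφρ hφ2 ha S
    (hω (bisectingAngle p₀ μ k₂)) hRβ (hβc β ⟨hβt.le, le_rfl⟩).le
  set e1 := Complex.exp (Complex.I * bisectingAngle p₀ μ k₁ * a) with he1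
  set e2 := Complex.exp (Complex.I * bisectingAngle p₀ μ k₂ * a) with he2
  -- The powers of `‖p₀‖` come from `Λ = N‖p₀‖`; `‖e1‖` and `‖e2‖` need not be 1 as `a` may be
  -- complex.
  refine ⟨C1 + ‖e1‖ * (C2 * ‖p₀‖ ^ (-κ)) + ‖e2‖ * (C3 * ‖p₀‖ ^ (-κ)) + C4, ?_⟩
  intro D' q K hD'o _ hD' hq hK N hN
  have hqρ : DifferentiableOn ℂ q (Metric.closedBall z₀ ρ) :=
    hq.mono fun z hz => hD' (Or.inl (hρnb hz))
  have hKρ : ∀ z ∈ Metric.closedBall z₀ ρ, ‖q z‖ ≤ K := fun z hz => hK z (Or.inl (hρnb hz))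
  have hqc : ContinuousOn (fun t => q (c t)) (Icc 0 1) :=
    hq.continuousOn.comp hc.continuousOn fun t ht => hD' (Or.inr (mem_image_of_mem c ht))
  have hKc : ∀ t ∈ Icc (0 : ℝ) 1, ‖q (c t)‖ ≤ K := fun t ht =>
    hK _ (Or.inr (mem_image_of_mem c ht))
  have hlocρ : ∀ z ∈ Metric.closedBall z₀ ρ, p z = p z₀ - p₀ * (z - z₀) ^ μ * (1 - φ z) :=
    fun z hz => hloc z (hρnb hz)
  obtain ⟨hi1, hb1⟩ := hC1 q K (hqc.mono hs1) (fun t ht => hKc t (hs1 ht)) N hN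
  obtain ⟨hi4, hb4⟩ := hC4 q K (hqc.mono hs4) (fun t ht => hKc t (hs4 ht)) N hN
  have ho2 : Ioo α t₀ ⊆ Ioo 0 1 := Ioo_subset_Ioo hαI.1 ht1.le
  have ho3 : Ioo t₀ β ⊆ Ioo 0 1 := Ioo_subset_Ioo ht0.le hβI.2
  obtain ⟨hi2, hv2⟩ := integral_perronIntegrand_along_ray (p := p) (ϑ := ϑ) (l := k₁) hμ ha hφρ hφ2
    hqρ hKρ hN hlocρ hαt.le hE (hc.continuousOn.mono hs2) (fun t ht => hEd t ⟨ho2 ht.1, ht.2⟩)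
    (hEc.mono fun t ht => ⟨ho2 ht.1, ht.2⟩)
    (fun t ht => hne t (Ioo_subset_Icc_self (ho2 ht)) ht.2.ne)
    (fun t ht => (hαc t ht).trans (half_lt_self hρ)) (Or.inr hαm) hαr hαϑ
  obtain ⟨hi3, hv3⟩ := integral_perronIntegrand_along_ray (p := p) (ϑ := ϑ) (l := k₂) hμ ha hφρ hφ2
    hqρ hKρ hN hlocρ hβt.le hE (hc.continuousOn.mono hs3) (fun t ht => hEd t ⟨ho3 ht.1, ht.2⟩)
    (hEc.mono fun t ht => ⟨ho3 ht.1, ht.2⟩)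
    (fun t ht => hne t (Ioo_subset_Icc_self (ho3 ht)) ht.1.ne')
    (fun t ht => (hβc t ht).trans (half_lt_self hρ)) (Or.inl hβm) hβr hβϑ
  rw [← he1] at hv2
  rw [← he2] at hv3
  refine ⟨((hi1.trans hi2).trans hi3).trans hi4, ?_⟩
  have hΛ : 0 < N * ‖p₀‖ := mul_pos hN (norm_pos_iff.2 hp₀)
  have hb2 := hC2 q K hqρ hKρ _ hΛ
  have hb3 := hC3 q K hqρ hKρ _ hΛ
  rw [← hκdef, Real.mul_rpow hN.le (norm_nonneg _)] at hb2 hb3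
  -- At `t₀` the radius is 0, so one primitive drops out of each piece; the incoming one keeps a
  -- minus sign, whence the difference of exponentials.
  simp only [hct₀, sub_self, norm_zero, intervalIntegral.integral_same, zero_sub, sub_zero,
    mul_neg] at hv2 hv3
  set P := Complex.exp (N * p z₀) with hP
  have hP0 : P ≠ 0 := Complex.exp_ne_zero _
  set I1 := ∫ t in (0 : ℝ)..α, perronIntegrand c z₀ ϑ a p q N t
  set I4 := ∫ t in β..(1 : ℝ), perronIntegrand c z₀ ϑ a p q N t
  set G1 := ∫ x in (0 : ℝ)..‖c α - z₀‖, rayIntegrand z₀ μ φ q a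
    (Complex.exp (Complex.I * bisectingAngle p₀ μ k₁)) (N * ‖p₀‖) x
  set G2 := ∫ x in (0 : ℝ)..‖c β - z₀‖, rayIntegrand z₀ μ φ q a
    (Complex.exp (Complex.I * bisectingAngle p₀ μ k₂)) (N * ‖p₀‖) x
  set T1 := ∑ s ∈ Finset.range S, (s.factorial : ℂ)⁻¹ *
    Complex.exp (Complex.I * bisectingAngle p₀ μ k₁) ^ s *
      (1 / μ * Complex.Gamma ((s + a) / μ) * ((N * ‖p₀‖ : ℝ) : ℂ) ^ (-((s + a) / μ)) *
        iteratedDeriv s (fun z => q z * (1 - φ z) ^ (-((s + a) / μ))) z₀) with hT1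
  set T2 := ∑ s ∈ Finset.range S, (s.factorial : ℂ)⁻¹ *
    Complex.exp (Complex.I * bisectingAngle p₀ μ k₂) ^ s *
      (1 / μ * Complex.Gamma ((s + a) / μ) * ((N * ‖p₀‖ : ℝ) : ℂ) ^ (-((s + a) / μ)) *
        iteratedDeriv s (fun z => q z * (1 - φ z) ^ (-((s + a) / μ))) z₀) with hT2
  have htot : ∫ t in (0 : ℝ)..1, perronIntegrand c z₀ ϑ a p q N t =
      I1 + -(P * e1 * G1) + P * e2 * G2 + I4 := by
    rw [← hv2, ← hv3, intervalIntegral.integral_add_adjacent_intervals hi1 hi2,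
      intervalIntegral.integral_add_adjacent_intervals (hi1.trans hi2) hi3,
      intervalIntegral.integral_add_adjacent_intervals ((hi1.trans hi2).trans hi3) hi4]
  have hsum : ∑ s ∈ Finset.range S, Complex.Gamma (((s : ℂ) + a) / (μ : ℂ)) *
      (perronCoeff μ p₀ a q φ z₀ s *
        (Complex.exp (2 * Real.pi * Complex.I * k₂ * ((s : ℂ) + a) / (μ : ℂ)) -
          Complex.exp (2 * Real.pi * Complex.I * k₁ * ((s : ℂ) + a) / (μ : ℂ)))) /
      (N : ℂ) ^ (((s : ℂ) + a) / (μ : ℂ)) = e2 * T2 - e1 * T1 := by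
    rw [hT1, hT2, Finset.mul_sum, Finset.mul_sum, ← Finset.sum_sub_distrib]
    refine Finset.sum_congr rfl fun s _ => ?_
    rw [he1, he2, perronCoeff_mul_exp hp₀ hN k₁ s, perronCoeff_mul_exp hp₀ hN k₂ s]
    ring
  -- The error collects the outer pieces, divided by `e^{N p(z₀)}`, and the two ray remainders.
  refine ⟨P⁻¹ * I1 + -(e1 * (G1 - T1)) + e2 * (G2 - T2) + P⁻¹ * I4, ?_, ?_⟩
  · have hPI : ∀ {I : ℂ} {C : ℝ}, ‖I‖ ≤ ‖P‖ * (C * K * N ^ (-κ)) →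
        ‖P⁻¹ * I‖ ≤ C * K * N ^ (-κ) := by
      intro I C h
      rw [norm_mul, norm_inv, inv_mul_le_iff₀ (norm_pos_iff.2 hP0)]
      exact h
    have h2 : ‖-(e1 * (G1 - T1))‖ ≤ ‖e1‖ * (C2 * K * (N ^ (-κ) * ‖p₀‖ ^ (-κ))) := by
      rw [norm_neg, norm_mul]; gcongr
    have h3 : ‖e2 * (G2 - T2)‖ ≤ ‖e2‖ * (C3 * K * (N ^ (-κ) * ‖p₀‖ ^ (-κ))) := by
      rw [norm_mul]; gcongr
    calc _ ≤ C1 * K * N ^ (-κ) + ‖e1‖ * (C2 * K * (N ^ (-κ) * ‖p₀‖ ^ (-κ))) +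
          ‖e2‖ * (C3 * K * (N ^ (-κ) * ‖p₀‖ ^ (-κ))) + C4 * K * N ^ (-κ) :=
          (norm_add_le _ _).trans (add_le_add ((norm_add_le _ _).trans
            (add_le_add ((norm_add_le _ _).trans (add_le_add (hPI hb1) h2)) h3)) (hPI hb4))
      _ = _ := by
          rw [div_eq_mul_inv K, ← Real.rpow_neg hN.le]; ring
  · rw [htot, hsum]
    field_simp
    ring
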